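/- An abelian $\ell$-group is an algebra $\langle L,\wedge,\vee,+,-,0\rangle$ such that $\langle L,\wedge,\vee\rangle$ is a lattice, $\langle L,+,-,0\rangle$ is an abelian group, and $a\le b$ implies $a+c\le b+c$. Let $\mathcal{LA}$ be the variety of all abelian $\ell$-groups; terms are built in this language over countably many variables, an equation is a pair of terms, and $s\le t$ stands for the equation $s\wedge t\approx s$. For a finite set of equations $\Gamma$, an equation $\varepsilon$ and an abelian $\ell$-group $L$, write $\Gamma\models_{L}\varepsilon$ if every assignment of elements of $L$ to the variables that satisfies all equations of $\Gamma$ satisfies $\varepsilon$, and $\Gamma\models_{\mathcal{LA}}\varepsilon$ if $\Gamma\models_L\varepsilon$ for every $L\in\mathcal{LA}$. Terms $t_1,\dots,t_n$ are $\mathcal{LA}$-dependent over $\Sigma$ if there is an equation $\varepsilon(y_1,\dots,y_n)$ with $\Sigma\models_{\mathcal{LA}}\varepsilon(t_1,\dots,t_n)$ and $\not\models_{\mathcal{LA}}\varepsilon$. A normalized system in a variable $x$ consists of inequations $$0\le s_i+nx\ (i\in I),\qquad 0\le t_j-nx\ (j\in J),\qquad 0\le u_k\ (k\in K),$$ where $n\ge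 1$, the sets $I,J,K$ are finite (possibly empty), and $s_i,t_j,u_k$ are terms in which $x$ does not occur. Then: 1. (Decidability.) It is decidable, given a finite set of equations $\Sigma$ and finitely many terms $t_1,\dots,t_n$, whether $t_1,\dots,t_n$ are $\mathcal{LA}$-dependent over $\Sigma$. 2. (Constructive coherence.) There is an algorithm that, given a finite set of variables $\overline y$ and a finite set of equations $\Gamma$ (which may contain further variables), computes a finite set of equations $\Pi(\overline y)$ such that for every equation $\varepsilon(\overline y)$: $\Gamma\models_{\mathcal{LA}}\varepsilon\iff\Pi\models_{\mathcal{LA}}\varepsilon$. 3. (Normalization.) There is an algorithm that, given a variable $x$ and a finite set of equations $\Gamma$, computes a normalized system $\Gamma'$ in $x$, whose terms $s_i,t_j,u_k$ contain only variables of $\Gamma$ other than $x$, such that $\Gamma\models_{\mathcal{LA}}\varepsilon\iff\Gamma'\models_{\mathcal{LA}}\varepsilon$ for every equation $\varepsilon$ in which $x$ does not occur. There is also an algorithm that computes from $x$ and $\Gamma$ a finite list of normalized systems $\Gamma_1,\dots,\Gamma_m$ of this kind such that an assignment of real numbers to the variables satisfies $\Gamma$ if and only if it satisfies at least one of $\Gamma_1,\dots,\Gamma_m$.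 4. (Elimination.) If $\Gamma$ is a normalized system in $x$ as displayed above and $$\Pi=\{0\le s_i+t_j\mid i\in I,\ j\in J\}\cup\{0\le u_k\mid k\in K\},$$ then for every equation $\varepsilon$ in which $x$ does not occur, $\Gamma\models_{\mathbb R}\varepsilon\iff\Pi\models_{\mathbb R}\varepsilon$ and $\Gamma\models_{\mathcal{LA}}\varepsilon\iff\Pi\models_{\mathcal{LA}}\varepsilon$. -/

import Mathlib

universe u

/-! ### Terms and equations in the language of abelian ℓ-groups -/

/-- Terms in the language `∧, ∨, +, -, 0` over the countable set of variables `x_0, x_1, …`. -/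
inductive LTerm : Type
  | var : ℕ → LTerm
  | zero : LTerm
  | neg : LTerm → LTerm
  | add : LTerm → LTerm → LTerm
  | inf : LTerm → LTerm → LTerm
  | sup : LTerm → LTerm → LTerm

namespace LTerm

/-- The finite set of variables occurring in a term. -/
def vars : LTerm → Finset ℕ
  | var i => {i}
  | zero => ∅
  | neg a => a.vars
  | add a b => a.vars ∪ b.vars
  | inf a b => a.vars ∪ b.vars
  | sup a b => a.vars ∪ b.vars

/-- Simultaneous substitution of terms for variables. -/
def subst (f : ℕ → LTerm) : LTerm → LTerm
  | var i => f i
  | zero => zero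
  | neg a => neg (a.subst f)
  | add a b => add (a.subst f) (b.subst f)
  | inf a b => inf (a.subst f) (b.subst f)
  | sup a b => sup (a.subst f) (b.subst f)

/-- The value of a term in an algebra under an assignment of the variables. -/
def eval {L : Type*} [Lattice L] [AddCommGroup L] (v : ℕ → L) : LTerm → L
  | var i => v i
  | zero => 0
  | neg a => -(a.eval v)
  | add a b => a.eval v + b.eval v
  | inf a b => a.eval v ⊓ b.eval v
  | sup a b => a.eval v ⊔ b.eval v

/-- The term `k t = t + … + t` (`k` summands). -/
def nmul : ℕ → LTerm → LTerm
  | 0, _ => zero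
  | k + 1, t => add (nmul k t) t

/-! The Gödel numbering of terms: a bijection with `ℕ`. -/

/-- The Gödel number of a term. -/
def toNat : LTerm → ℕ
  | zero => 0
  | var i => 5 * i + 1
  | neg a => 5 * a.toNat + 1 + 1
  | add a b => 5 * Nat.pair a.toNat b.toNat + 2 + 1
  | inf a b => 5 * Nat.pair a.toNat b.toNat + 3 + 1
  | sup a b => 5 * Nat.pair a.toNat b.toNat + 4 + 1

/-- The term with a given Gödel number. -/
def ofNat : ℕ → LTerm
  | 0 => zero
  | m + 1 =>
    have h0 : m / 5 < m + 1 := Nat.lt_succ_of_le (Nat.div_le_self m 5)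
    have _h1 : (m / 5).unpair.1 < m + 1 := lt_of_le_of_lt (Nat.unpair_left_le _) h0
    have _h2 : (m / 5).unpair.2 < m + 1 := lt_of_le_of_lt (Nat.unpair_right_le _) h0
    match m % 5 with
    | 0 => var (m / 5)
    | 1 => neg (ofNat (m / 5))
    | 2 => add (ofNat (m / 5).unpair.1) (ofNat (m / 5).unpair.2)
    | 3 => inf (ofNat (m / 5).unpair.1) (ofNat (m / 5).unpair.2)
    | _ => sup (ofNat (m / 5).unpair.1) (ofNat (m / 5).unpair.2)

theorem ofNat_toNat (t : LTerm) : ofNat t.toNat = t := by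
  induction t with
  | zero => simp [toNat, ofNat]
  | var i => simp [toNat, ofNat]
  | neg a ha =>
    have h : (5 * a.toNat + 1) / 5 = a.toNat := by omega
    simp [toNat, ofNat, Nat.add_mod, h, ha]
  | add a b ha hb =>
    have h : (5 * Nat.pair a.toNat b.toNat + 2) / 5 = Nat.pair a.toNat b.toNat := by omega
    simp [toNat, ofNat, Nat.add_mod, h, ha, hb]
  | inf a b ha hb =>
    have h : (5 * Nat.pair a.toNat b.toNat + 3) / 5 = Nat.pair a.toNat b.toNat := by omega
    simp [toNat, ofNat, Nat.add_mod, h, ha, hb]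
  | sup a b ha hb =>
    have h : (5 * Nat.pair a.toNat b.toNat + 4) / 5 = Nat.pair a.toNat b.toNat := by omega
    simp [toNat, ofNat, Nat.add_mod, h, ha, hb]

theorem toNat_ofNat (n : ℕ) : (ofNat n).toNat = n := by
  induction n using Nat.strong_induction_on with
  | _ n ih =>
    cases n with
    | zero => simp [toNat, ofNat]
    | succ m =>
      have h0 : m / 5 < m + 1 := Nat.lt_succ_of_le (Nat.div_le_self m 5)
      have e0 := ih _ h0
      have e1 := ih _ (lt_of_le_of_lt (Nat.unpair_left_le (m / 5)) h0)
      have e2 := ih _ (lt_of_le_of_lt (Nat.unpair_right_le (m / 5)) h0)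
      have hm : 5 * (m / 5) + m % 5 = m := Nat.div_add_mod m 5
      have hlt : m % 5 < 5 := Nat.mod_lt _ (by norm_num)
      have hc : m % 5 = 0 ∨ m % 5 = 1 ∨ m % 5 = 2 ∨ m % 5 = 3 ∨ m % 5 = 4 := by omega
      rcases hc with h | h | h | h | h <;>
        simp only [ofNat, h, toNat, e0, e1, e2, Nat.pair_unpair] <;> omega

/-- Terms correspond to natural numbers via their Gödel numbers. -/
def equivNat : LTerm ≃ ℕ where
  toFun := toNat
  invFun := ofNat
  left_inv := ofNat_toNat
  right_inv := toNat_ofNat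

/-- The effective coding of terms used to speak of computable functions and decidable predicates. -/
instance : Primcodable LTerm := Primcodable.ofEquiv ℕ equivNat

end LTerm

/-- An equation `s ≈ t` is a pair of terms. -/
abbrev LEqn : Type := LTerm × LTerm

namespace LEqn

/-- The variables occurring in an equation. -/
def vars (e : LEqn) : Finset ℕ := e.1.vars ∪ e.2.vars

/-- Substitution in an equation. -/
def subst (f : ℕ → LTerm) (e : LEqn) : LEqn := (e.1.subst f, e.2.subst f)

/-- The equation holds under the assignment `v`. -/
def Holds {L : Type*} [Lattice L] [AddCommGroup L] (v : ℕ → L) (e : LEqn) : Prop :=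
  e.1.eval v = e.2.eval v

/-- The inequation `s ≤ t`, i.e. the equation `s ∧ t ≈ s`. -/
def le (s t : LTerm) : LEqn := (LTerm.inf s t, s)

end LEqn

/-! ### Equational consequence and dependence -/

/-- `Γ ⊨_L ε` for a single algebra `L`. -/
def EntailsIn (L : Type*) [Lattice L] [AddCommGroup L] (Γ : List LEqn) (ε : LEqn) : Prop :=
  ∀ v : ℕ → L, (∀ e ∈ Γ, e.Holds v) → ε.Holds v

/-- `Γ ⊨ ε` for the variety of all abelian ℓ-groups. -/
def EntailsLA (Γ : List LEqn) (ε : LEqn) : Prop :=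
  ∀ (L : Type u) [Lattice L] [AddCommGroup L] [IsOrderedAddMonoid L], EntailsIn L Γ ε

/-- The terms `t_0, …, t_{n-1}` are dependent over the finite set of equations `Γ` for the variety
of abelian ℓ-groups: some equation `ε(y_0, …, y_{n-1})` that is not valid in all abelian ℓ-groups
satisfies `Γ ⊨ ε(t_0, …, t_{n-1})`. -/
def DependentOver (Γ : List LEqn) (ts : List LTerm) : Prop :=
  ∃ ε : LEqn, ε.vars ⊆ Finset.range ts.length ∧
    EntailsLA.{u} Γ (ε.subst fun i => ts.getD i LTerm.zero) ∧ ¬ EntailsLA.{u} [] ε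

/-! ### Normalized systems of inequations in one distinguished variable -/

/-- The data of a system `0 ≤ s_i + n x`, `0 ≤ t_j - n x`, `0 ≤ u_k`. -/
structure NormalSystem where
  n : ℕ
  s : List LTerm
  t : List LTerm
  u : List LTerm

namespace NormalSystem

/-- A system is the same as a 4-tuple `(n, s, t, u)`. -/
def equivProd : NormalSystem ≃ ℕ × List LTerm × List LTerm × List LTerm where
  toFun N := (N.n, N.s, N.t, N.u)
  invFun p := ⟨p.1, p.2.1, p.2.2.1, p.2.2.2⟩
  left_inv _ := rfl
  right_inv _ := rfl

instance : Primcodable NormalSystem := Primcodable.ofEquiv _ equivProd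

/-- `n ≥ 1`, and all variables of the terms `s_i`, `t_j`, `u_k` are in `Y`. -/
def IsOver (N : NormalSystem) (Y : Set ℕ) : Prop :=
  1 ≤ N.n ∧ (∀ a ∈ N.s, (a.vars : Set ℕ) ⊆ Y) ∧ (∀ a ∈ N.t, (a.vars : Set ℕ) ⊆ Y) ∧
    ∀ a ∈ N.u, (a.vars : Set ℕ) ⊆ Y

/-- The inequations `0 ≤ s_i + n x`, `0 ≤ t_j - n x`, `0 ≤ u_k`. -/
def eqns (N : NormalSystem) (x : ℕ) : List LEqn :=
  N.s.map (fun a => LEqn.le .zero (.add a (.nmul N.n (.var x)))) ++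
  N.t.map (fun a => LEqn.le .zero (.add a (.neg (.nmul N.n (.var x))))) ++
  N.u.map (fun a => LEqn.le .zero a)

/-- The inequations `0 ≤ s_i + t_j` (for all `i`, `j`) and `0 ≤ u_k`. -/
def elim (N : NormalSystem) : List LEqn :=
  N.s.flatMap (fun a => N.t.map fun b => LEqn.le .zero (.add a b)) ++
  N.u.map (fun a => LEqn.le .zero a)

end NormalSystem

/-! ### Primitive recursive functions on terms -/

namespace LTerm

/-! In a totally ordered abelian group a term is piecewise linear in a chosen variable `x`: it has
finitely many branches, each a linear form that is valid where certain other linear forms are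
nonnegative (`LTerm.branches_covers`). So `Γ` is equivalent, assignment by assignment, to a finite
disjunction of systems of linear inequalities. Such groups are torsion-free, hence the coefficients
of `x` can be scaled to a common value (`holds_iff_normalForms`). Fourier–Motzkin elimination
removes `x` from each disjunct; it is sound in every abelian ℓ-group and exact over `ℝ`. Under a
total order, a disjunction of conjunctions of conditions `0 ≤ a` is one inequality `0 ≤` (join of
meets), so the outcome is again an equation and elimination can be iterated (`elimVar`, `project`).

Consequence over all abelian ℓ-groups is reduced to `ℝ` by `entailsLA_iff_real`. To test whether `Γ`
entails `a ≈ b`, add `z ≤ |a - b|` with `z` fresh and project to `z`. The normal forms in `z`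
contain no other variable, so their remaining terms have value 0, and a positive `z` is admitted
exactly by a form without upper bounds. If such a form exists, `z = 1` lifts to a real
counterexample. If none exists, soundness of elimination excludes counterexamples in every totally
ordered group, and hence in every abelian ℓ-group, because elements that are not nonnegative become
negative in some totally ordered quotient (`exists_linearOrder_quotient`). No embedding of ordered
groups into function spaces is involved: a finite computation certifies the consequence.

Coherence is then given by `project`. For dependence, the terms are named by fresh variables and the
system is projected onto these. The result axiomatizes all relations between the terms, so they are
dependent if and only if one of its finitely many equations is not valid (`dependentOver_iff`). All
algorithms are primitive recursive, recursion on terms being supplied by `primrec_fold`. -/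

theorem primrec_toNat : Primrec toNat := Primrec.of_equiv (e := equivNat)

theorem primrec_of_toNat {α : Type*} [Primcodable α] {f : α → LTerm}
    (h : Primrec fun a => (f a).toNat) : Primrec f :=
  Primrec.encode_iff.1 h

theorem primrec_var : Primrec var :=
  primrec_of_toNat <| Primrec.succ.comp (Primrec.nat_mul.comp (Primrec.const 5) Primrec.id)

theorem primrec_neg : Primrec neg :=
  primrec_of_toNat <| Primrec.succ.comp <| Primrec.succ.comp <|
    Primrec.nat_mul.comp (Primrec.const 5) primrec_toNat

theorem primrec_pairNode (k : ℕ) :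
    Primrec fun p : LTerm × LTerm => 5 * Nat.pair p.1.toNat p.2.toNat + k + 1 :=
  Primrec.succ.comp <| Primrec.nat_add.comp
    (Primrec.nat_mul.comp (Primrec.const 5) (Primrec₂.natPair.comp
      (primrec_toNat.comp Primrec.fst) (primrec_toNat.comp Primrec.snd))) (Primrec.const k)

theorem primrec_add : Primrec₂ add := primrec_of_toNat (primrec_pairNode 2)

theorem primrec_inf : Primrec₂ inf := primrec_of_toNat (primrec_pairNode 3)

theorem primrec_sup : Primrec₂ sup := primrec_of_toNat (primrec_pairNode 4)

theorem primrec_nmul : Primrec₂ nmul :=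
  (Primrec.nat_rec (f := fun _ : LTerm => zero) (g := fun t p => add p.2 t) (Primrec.const _)
    (primrec_add.comp (Primrec.snd.comp Primrec.snd) Primrec.fst).to₂).comp
      Primrec.snd Primrec.fst |>.of_eq fun p => by
    obtain ⟨n, t⟩ := p
    induction n with
    | zero => rfl
    | succ n ih => simp only [nmul] at *; rw [← ih]

/-- The homomorphism from terms to an algebra with the given operations. -/
def fold {β : Type*} (V : ℕ → β) (Z : β) (N : β → β) (A I S : β → β → β) : LTerm → β
  | var i => V i
  | zero => Z
  | neg a => N (a.fold V Z N A I S)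
  | add a b => A (a.fold V Z N A I S) (b.fold V Z N A I S)
  | inf a b => I (a.fold V Z N A I S) (b.fold V Z N A I S)
  | sup a b => S (a.fold V Z N A I S) (b.fold V Z N A I S)

/-- Course-of-values recursion on Gödel numbers: the code of a term exceeds the codes of its
immediate subterms, so the list of values at all smaller numbers already contains the values needed.
-/
theorem primrec_fold {α β : Type*} [Primcodable α] [Primcodable β] {V : α → ℕ → β} {Z : β}
    {N : β → β} {A I S : β → β → β} (hV : Primrec₂ V) (hN : Primrec N)
    (hA : Primrec₂ A) (hI : Primrec₂ I) (hS : Primrec₂ S) :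
    Primrec₂ fun a t => fold (V a) Z N A I S t := by
  let pick : (β → β → β) → ℕ → List β → Option β := fun op m l =>
    l[(m / 5).unpair.1]?.bind fun b => l[(m / 5).unpair.2]?.map fun c => op b c
  let step : α → List β → ℕ → Option β := fun a l m =>
    if m % 5 = 0 then some (V a (m / 5))
    else if m % 5 = 1 then l[m / 5]?.map N
    else if m % 5 = 2 then pick A m l
    else if m % 5 = 3 then pick I m l
    else pick S m l
  -- The list holds the values at all numbers below the current code, so its length is that code;
  -- `step` receives the code minus one, whose residue mod 5 names the constructor.
  let g : α → List β → Option β := fun a l =>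
    Nat.casesOn (motive := fun _ => Option β) l.length (some Z) (step a l)
  have hdiv : Primrec fun p : (α × List β) × ℕ => p.2 / 5 :=
    Primrec.nat_div.comp Primrec.snd (Primrec.const 5)
  have hl : Primrec fun p : (α × List β) × ℕ => p.1.2 := Primrec.snd.comp Primrec.fst
  have hpick : ∀ op : β → β → β, Primrec₂ op →
      Primrec fun p : (α × List β) × ℕ => pick op p.2 p.1.2 := fun op hop =>
    Primrec.option_bind
      (Primrec.list_getElem?.comp hl (Primrec.fst.comp (Primrec.unpair.comp hdiv)))
      (Primrec.option_map
        (Primrec.list_getElem?.comp (hl.comp Primrec.fst)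
          (Primrec.snd.comp (Primrec.unpair.comp (hdiv.comp Primrec.fst))))
        (hop.comp (Primrec.snd.comp Primrec.fst) Primrec.snd).to₂).to₂
  have hmod : ∀ k : ℕ, PrimrecPred fun p : (α × List β) × ℕ => p.2 % 5 = k := fun k =>
    Primrec.eq.comp (Primrec.nat_mod.comp Primrec.snd (Primrec.const 5)) (Primrec.const k)
  have hstep : Primrec fun p : (α × List β) × ℕ => step p.1.1 p.1.2 p.2 :=
    Primrec.ite (hmod 0)
      (Primrec.option_some.comp (hV.comp (Primrec.fst.comp Primrec.fst) hdiv))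
      (Primrec.ite (hmod 1)
        (Primrec.option_map (Primrec.list_getElem?.comp hl hdiv) (hN.comp Primrec.snd).to₂)
        (Primrec.ite (hmod 2) (hpick A hA) (Primrec.ite (hmod 3) (hpick I hI) (hpick S hS))))
  have hg : Primrec₂ g :=
    Primrec.nat_casesOn (Primrec.list_length.comp Primrec.snd) (Primrec.const _) hstep.to₂
  have key : Primrec₂ fun a n => fold (V a) Z N A I S (ofNat n) := by
    refine Primrec.nat_strong_rec _ hg fun a n => ?_
    cases n with
    | zero => simp [g, ofNat, fold]
    | succ m =>
      have h0 : m / 5 < m + 1 := Nat.lt_succ_of_le (Nat.div_le_self m 5)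
      have h1 : (m / 5).unpair.1 < m + 1 := lt_of_le_of_lt (Nat.unpair_left_le _) h0
      have h2 : (m / 5).unpair.2 < m + 1 := lt_of_le_of_lt (Nat.unpair_right_le _) h0
      have hlt : m % 5 < 5 := Nat.mod_lt _ (by norm_num)
      have hc : m % 5 = 0 ∨ m % 5 = 1 ∨ m % 5 = 2 ∨ m % 5 = 3 ∨ m % 5 = 4 := by omega
      rcases hc with h | h | h | h | h <;>
        simp [g, step, pick, ofNat, h, fold, h0, h1, h2]
  exact (key.comp Primrec.fst (primrec_toNat.comp Primrec.snd)).of_eq fun p => by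
    simp only [ofNat_toNat]

end LTerm

/-! ### Primitive recursive access to normalized systems -/

namespace NormalSystem

theorem primrec_equivProd : Primrec equivProd := Primrec.of_equiv

theorem primrec_n : Primrec NormalSystem.n := Primrec.fst.comp primrec_equivProd

theorem primrec_s : Primrec NormalSystem.s :=
  Primrec.fst.comp (Primrec.snd.comp primrec_equivProd)

theorem primrec_t : Primrec NormalSystem.t :=
  Primrec.fst.comp (Primrec.snd.comp (Primrec.snd.comp primrec_equivProd))

theorem primrec_u : Primrec NormalSystem.u :=
  Primrec.snd.comp (Primrec.snd.comp (Primrec.snd.comp primrec_equivProd))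

theorem primrec_mk {α : Type*} [Primcodable α] {n : α → ℕ} {s t u : α → List LTerm}
    (hn : Primrec n) (hs : Primrec s) (ht : Primrec t) (hu : Primrec u) :
    Primrec fun a => NormalSystem.mk (n a) (s a) (t a) (u a) :=
  (Primrec.of_equiv_symm (e := equivProd)).comp (hn.pair (hs.pair (ht.pair hu)))

end NormalSystem

/-! ### Linear forms, branches and systems of linear inequalities -/

/-- The triple `(p, q, r)` stands for the linear form `p x - q x + r` in a variable `x`. -/
abbrev LinForm : Type := ℕ × ℕ × LTerm

namespace LinForm

/-- The negative of a linear form. -/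
def neg (k : LinForm) : LinForm := (k.2.1, k.1, .neg k.2.2)

/-- The sum of two linear forms. -/
def add (k l : LinForm) : LinForm := (k.1 + l.1, k.2.1 + l.2.1, .add k.2.2 l.2.2)

/-- The difference of two linear forms. -/
def sub (k l : LinForm) : LinForm := add k (neg l)

/-- The absolute value of the coefficient of `x`, replaced by `1` if it is `0`. -/
def coeff (k : LinForm) : ℕ := max 1 ((k.1 - k.2.1) + (k.2.1 - k.1))

theorem primrec_neg : Primrec neg :=
  (Primrec.fst.comp Primrec.snd).pair
    (Primrec.fst.pair (LTerm.primrec_neg.comp (Primrec.snd.comp Primrec.snd)))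

theorem primrec_add : Primrec₂ add :=
  (Primrec.nat_add.comp (Primrec.fst.comp Primrec.fst) (Primrec.fst.comp Primrec.snd)).pair
    ((Primrec.nat_add.comp (Primrec.fst.comp (Primrec.snd.comp Primrec.fst))
      (Primrec.fst.comp (Primrec.snd.comp Primrec.snd))).pair
      (LTerm.primrec_add.comp (Primrec.snd.comp (Primrec.snd.comp Primrec.fst))
        (Primrec.snd.comp (Primrec.snd.comp Primrec.snd))))

theorem primrec_sub : Primrec₂ sub :=
  primrec_add.comp Primrec.fst (primrec_neg.comp Primrec.snd)

theorem primrec_coeff : Primrec coeff :=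
  have h1 : Primrec fun k : LinForm => k.1 := Primrec.fst
  have h2 : Primrec fun k : LinForm => k.2.1 := Primrec.fst.comp Primrec.snd
  Primrec.nat_max.comp (Primrec.const 1)
    (Primrec.nat_add.comp (Primrec.nat_sub.comp h1 h2) (Primrec.nat_sub.comp h2 h1))

end LinForm

/-- A linear form `b.2` together with inequalities `0 ≤ k` (`k ∈ b.1`) that single out the region
on which it is used. -/
abbrev Branch : Type := List LinForm × LinForm

namespace Branch

/-- Combine each branch of one list with each branch of another list. -/
def combine (h : Branch → Branch → List Branch) (A B : List Branch) : List Branch :=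
  A.flatMap fun a => B.flatMap fun b => h a b

/-- The negative of a branch. -/
def neg (a : Branch) : Branch := (a.1, LinForm.neg a.2)

/-- The sum of two branches. -/
def add (a b : Branch) : List Branch := [(a.1 ++ b.1, LinForm.add a.2 b.2)]

/-- The two branches of the meet. -/
def inf (a b : Branch) : List Branch :=
  [(LinForm.sub b.2 a.2 :: (a.1 ++ b.1), a.2), (LinForm.sub a.2 b.2 :: (a.1 ++ b.1), b.2)]

/-- The two branches of the join. -/
def sup (a b : Branch) : List Branch :=
  [(LinForm.sub a.2 b.2 :: (a.1 ++ b.1), a.2), (LinForm.sub b.2 a.2 :: (a.1 ++ b.1), b.2)]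

/-- The branches of a variable, where `x` is the distinguished variable. -/
def ofVar (x i : ℕ) : List Branch :=
  if i = x then [([], (1, 0, .zero))] else [([], (0, 0, .var i))]

theorem primrec_combine {h : Branch → Branch → List Branch} (hh : Primrec₂ h) :
    Primrec₂ (combine h) :=
  Primrec.list_flatMap Primrec.fst
    (Primrec.list_flatMap (Primrec.snd.comp Primrec.fst)
      (hh.comp (Primrec.snd.comp Primrec.fst) Primrec.snd).to₂).to₂

theorem primrec_neg : Primrec neg :=
  Primrec.fst.pair (LinForm.primrec_neg.comp Primrec.snd)

theorem primrec_conditions :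
    Primrec fun p : Branch × Branch => p.1.1 ++ p.2.1 :=
  Primrec.list_append.comp (Primrec.fst.comp Primrec.fst) (Primrec.fst.comp Primrec.snd)

theorem primrec_sub_left :
    Primrec fun p : Branch × Branch => LinForm.sub p.1.2 p.2.2 :=
  LinForm.primrec_sub.comp (Primrec.snd.comp Primrec.fst) (Primrec.snd.comp Primrec.snd)

theorem primrec_sub_right :
    Primrec fun p : Branch × Branch => LinForm.sub p.2.2 p.1.2 :=
  LinForm.primrec_sub.comp (Primrec.snd.comp Primrec.snd) (Primrec.snd.comp Primrec.fst)

theorem primrec_add : Primrec₂ add :=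
  Primrec.list_cons.comp
    (primrec_conditions.pair (LinForm.primrec_add.comp (Primrec.snd.comp Primrec.fst)
      (Primrec.snd.comp Primrec.snd))) (Primrec.const [])

theorem primrec_inf : Primrec₂ inf :=
  Primrec.list_cons.comp
    ((Primrec.list_cons.comp primrec_sub_right primrec_conditions).pair
      (Primrec.snd.comp Primrec.fst))
    (Primrec.list_cons.comp
      ((Primrec.list_cons.comp primrec_sub_left primrec_conditions).pair
        (Primrec.snd.comp Primrec.snd)) (Primrec.const []))

theorem primrec_sup : Primrec₂ sup :=
  Primrec.list_cons.comp
    ((Primrec.list_cons.comp primrec_sub_left primrec_conditions).pair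
      (Primrec.snd.comp Primrec.fst))
    (Primrec.list_cons.comp
      ((Primrec.list_cons.comp primrec_sub_right primrec_conditions).pair
        (Primrec.snd.comp Primrec.snd)) (Primrec.const []))

theorem primrec_ofVar : Primrec₂ ofVar :=
  Primrec.ite (Primrec.eq.comp Primrec.snd Primrec.fst) (Primrec.const _)
    (Primrec.list_cons.comp ((Primrec.const []).pair ((Primrec.const 0).pair
      ((Primrec.const 0).pair (LTerm.primrec_var.comp Primrec.snd)))) (Primrec.const []))

end Branch

/-- The linear branches of a term, with respect to the variable `x`. -/
def LTerm.branches (x : ℕ) (t : LTerm) : List Branch :=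
  t.fold (Branch.ofVar x) [([], (0, 0, .zero))] (List.map Branch.neg)
    (Branch.combine Branch.add) (Branch.combine Branch.inf) (Branch.combine Branch.sup)

theorem LTerm.primrec_branches : Primrec₂ LTerm.branches :=
  LTerm.primrec_fold Branch.primrec_ofVar
    (Primrec.list_map Primrec.id (Branch.primrec_neg.comp Primrec.snd).to₂)
    (Branch.primrec_combine Branch.primrec_add) (Branch.primrec_combine Branch.primrec_inf)
    (Branch.primrec_combine Branch.primrec_sup)

/-- The systems of linear inequalities whose disjunction is the equation `e`. -/
def LEqn.systems (x : ℕ) (e : LEqn) : List (List LinForm) :=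
  (e.1.branches x).flatMap fun a => (e.2.branches x).map fun b =>
    LinForm.sub a.2 b.2 :: LinForm.sub b.2 a.2 :: (a.1 ++ b.1)

theorem LEqn.primrec_systems : Primrec₂ LEqn.systems :=
  Primrec.list_flatMap
    (LTerm.primrec_branches.comp Primrec.fst (Primrec.fst.comp Primrec.snd))
    (Primrec.list_map
      (LTerm.primrec_branches.comp (Primrec.fst.comp Primrec.fst)
        (Primrec.snd.comp (Primrec.snd.comp Primrec.fst)))
      ((Primrec.list_cons.comp Branch.primrec_sub_left
        (Primrec.list_cons.comp Branch.primrec_sub_right Branch.primrec_conditions)).comp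
          ((Primrec.snd.comp Primrec.fst).pair Primrec.snd)).to₂).to₂

/-- The systems of linear inequalities whose disjunction is the conjunction of the equations `Γ`. -/
def linearSystems (x : ℕ) (Γ : List LEqn) : List (List LinForm) :=
  Γ.foldr (fun e S => (e.systems x).flatMap fun c => S.map fun d => c ++ d) [[]]

theorem primrec_linearSystems : Primrec₂ linearSystems :=
  Primrec.list_foldr Primrec.snd (Primrec.const [[]])
    (Primrec.list_flatMap
      (LEqn.primrec_systems.comp (Primrec.fst.comp Primrec.fst) (Primrec.fst.comp Primrec.snd))
      (Primrec.list_map (Primrec.snd.comp (Primrec.snd.comp Primrec.fst))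
        (Primrec.list_append.comp (Primrec.snd.comp Primrec.fst) Primrec.snd).to₂).to₂).to₂

/-- The product of the absolute values of the nonzero coefficients of `x`. -/
def commonCoeff (c : List LinForm) : ℕ := c.foldr (fun k m => k.coeff * m) 1

theorem primrec_commonCoeff : Primrec commonCoeff :=
  Primrec.list_foldr Primrec.id (Primrec.const 1)
    (Primrec.nat_mul.comp (LinForm.primrec_coeff.comp (Primrec.fst.comp Primrec.snd))
      (Primrec.snd.comp Primrec.snd)).to₂

/-- The normalized system obtained by scaling all coefficients of `x` to a common value. -/
def normalizeSystem (c : List LinForm) : NormalSystem where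
  n := commonCoeff c
  s := (c.filter fun k => k.2.1 < k.1).map fun k => .nmul (commonCoeff c / k.coeff) k.2.2
  t := (c.filter fun k => k.1 < k.2.1).map fun k => .nmul (commonCoeff c / k.coeff) k.2.2
  u := (c.filter fun k => k.1 = k.2.1).map fun k => k.2.2

theorem primrec_normalizeSystem : Primrec normalizeSystem := by
  have h1 : Primrec fun k : LinForm => k.1 := Primrec.fst
  have h2 : Primrec fun k : LinForm => k.2.1 := Primrec.fst.comp Primrec.snd
  have h3 : Primrec₂ fun (c : List LinForm) (k : LinForm) =>
      LTerm.nmul (commonCoeff c / k.coeff) k.2.2 :=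
    LTerm.primrec_nmul.comp
      (Primrec.nat_div.comp (primrec_commonCoeff.comp Primrec.fst)
        (LinForm.primrec_coeff.comp Primrec.snd))
      (Primrec.snd.comp (Primrec.snd.comp Primrec.snd))
  exact NormalSystem.primrec_mk primrec_commonCoeff
    (Primrec.list_map (Primrec.listFilter (Primrec.nat_lt.comp h2 h1)) h3)
    (Primrec.list_map (Primrec.listFilter (Primrec.nat_lt.comp h1 h2)) h3)
    (Primrec.list_map (Primrec.listFilter (Primrec.eq.comp h1 h2))
      ((Primrec.snd.comp Primrec.snd).comp Primrec.snd).to₂)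

/-- The normalized systems in `x` whose disjunction is the conjunction of the equations `Γ`. -/
def normalForms (x : ℕ) (Γ : List LEqn) : List NormalSystem := (linearSystems x Γ).map normalizeSystem

theorem primrec_normalForms : Primrec₂ normalForms :=
  Primrec.list_map primrec_linearSystems (primrec_normalizeSystem.comp Primrec.snd).to₂

/-! ### Elimination of variables -/

/-- The terms of the system obtained by eliminating the variable from a normalized system. -/
def NormalSystem.elimTerms (N : NormalSystem) : List LTerm :=
  (N.s.flatMap fun a => N.t.map fun b => .add a b) ++ N.u

theorem NormalSystem.primrec_elimTerms : Primrec NormalSystem.elimTerms :=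
  Primrec.list_append.comp
    (Primrec.list_flatMap primrec_s
      (Primrec.list_map (primrec_t.comp Primrec.fst)
        (LTerm.primrec_add.comp (Primrec.snd.comp Primrec.fst) Primrec.snd).to₂).to₂)
    primrec_u

/-- A term that is nonnegative if and only if all terms of the list are nonnegative. -/
def infList (l : List LTerm) : LTerm := l.foldr .inf .zero

/-- A term whose value is the largest value of the terms of a nonempty list. -/
def supList (l : List LTerm) : LTerm := l.foldr .sup (l.head?.getD .zero)

theorem primrec_infList : Primrec infList :=
  Primrec.list_foldr Primrec.id (Primrec.const _) (LTerm.primrec_inf.comp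
    (Primrec.fst.comp Primrec.snd) (Primrec.snd.comp Primrec.snd)).to₂

theorem primrec_supList : Primrec supList :=
  Primrec.list_foldr Primrec.id
    (Primrec.option_getD.comp Primrec.list_head? (Primrec.const _)) (LTerm.primrec_sup.comp
      (Primrec.fst.comp Primrec.snd) (Primrec.snd.comp Primrec.snd)).to₂

/-- A term that is nonnegative if and only if `Γ` is satisfied by some choice of a value for `x`. -/
def elimTerm (x : ℕ) (Γ : List LEqn) : LTerm :=
  supList ((normalForms x Γ).map fun N => infList N.elimTerms)

theorem primrec_elimTerm : Primrec₂ elimTerm :=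
  primrec_supList.comp (Primrec.list_map primrec_normalForms
    (primrec_infList.comp (NormalSystem.primrec_elimTerms.comp Primrec.snd)).to₂)

/-- Elimination of one variable. -/
def elimVar (x : ℕ) (Γ : List LEqn) : List LEqn := [LEqn.le .zero (elimTerm x Γ)]

theorem LEqn.primrec_le : Primrec₂ LEqn.le :=
  Primrec.pair LTerm.primrec_inf Primrec.fst

theorem primrec_elimVar : Primrec₂ elimVar :=
  Primrec.list_cons.comp (LEqn.primrec_le.comp (Primrec.const _) primrec_elimTerm)
    (Primrec.const [])

/-- Elimination of a list of variables. -/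
def elimVars (xs : List ℕ) (Γ : List LEqn) : List LEqn := xs.foldl (fun Δ x => elimVar x Δ) Γ

theorem primrec_elimVars : Primrec₂ elimVars :=
  Primrec.list_foldl Primrec.fst Primrec.snd
    (primrec_elimVar.comp (Primrec.snd.comp Primrec.snd) (Primrec.fst.comp Primrec.snd)).to₂

/-- The list of variables of a term. -/
def LTerm.varList (t : LTerm) : List ℕ :=
  t.fold (fun i => [i]) [] id (· ++ ·) (· ++ ·) (· ++ ·)

theorem LTerm.primrec_varList : Primrec LTerm.varList :=
  (LTerm.primrec_fold (α := Unit) (V := fun _ i => [i]) (Z := [])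
    (Primrec.list_cons.comp Primrec.snd (Primrec.const [])).to₂
    Primrec.id Primrec.list_append Primrec.list_append Primrec.list_append).comp
      (Primrec.const ()) Primrec.id

/-- The list of variables of a list of equations. -/
def varsOf (Γ : List LEqn) : List ℕ := Γ.flatMap fun e => e.1.varList ++ e.2.varList

theorem primrec_varsOf : Primrec varsOf :=
  Primrec.list_flatMap Primrec.id
    (Primrec.list_append.comp (LTerm.primrec_varList.comp (Primrec.fst.comp Primrec.snd))
      (LTerm.primrec_varList.comp (Primrec.snd.comp Primrec.snd))).to₂

/-- A number larger than all variables of a list of equations. -/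
def freshVar (Γ : List LEqn) : ℕ := (varsOf Γ).foldr (fun i m => max (i + 1) m) 0

theorem primrec_freshVar : Primrec freshVar :=
  Primrec.list_foldr primrec_varsOf (Primrec.const 0)
    (Primrec.nat_max.comp (Primrec.succ.comp (Primrec.fst.comp Primrec.snd))
      (Primrec.snd.comp Primrec.snd)).to₂

/-- The members of a list of numbers that do not belong to another list. -/
def listDiff (l ys : List ℕ) : List ℕ := l.filter fun i => ∀ y ∈ ys, y ≠ i

theorem primrec_listDiff : Primrec₂ listDiff := by
  have h : PrimrecRel fun (ys : List ℕ) (i : ℕ) => ∀ y ∈ ys, y ≠ i :=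
    PrimrecRel.forall_mem_list (R := fun y i : ℕ => y ≠ i) (PrimrecPred.not Primrec.eq)
  exact PrimrecRel.listFilter (R := fun i (ys : List ℕ) => ∀ y ∈ ys, y ≠ i) h.swap

/-- Elimination of all variables except those in `ys`. -/
def project (ys : List ℕ) (Γ : List LEqn) : List LEqn := elimVars (listDiff (varsOf Γ) ys) Γ

theorem primrec_project : Primrec₂ project :=
  primrec_elimVars.comp
    (primrec_listDiff.comp (primrec_varsOf.comp Primrec.snd) Primrec.fst) Primrec.snd

/-- The equations `Γ` together with an inequality expressing that `ε` fails by at least the value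
of the variable `z`. -/
def refutation (z : ℕ) (Γ : List LEqn) (ε : LEqn) : List LEqn :=
  LEqn.le (.var z) (.sup (.add ε.1 (.neg ε.2)) (.add ε.2 (.neg ε.1))) :: Γ

/-- The decision procedure for consequence: no normal form, with respect to a fresh variable `z`,
of the projection of the refutation system to `z` is satisfied by a positive value of `z`. -/
def Decides (Γ : List LEqn) (ε : LEqn) : Prop :=
  ∀ N ∈ normalForms (freshVar (ε :: Γ))
    (project [freshVar (ε :: Γ)] (refutation (freshVar (ε :: Γ)) Γ ε)), ¬ N.t.length = 0

theorem primrec_refutation :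
    Primrec fun p : ℕ × List LEqn × LEqn => refutation p.1 p.2.1 p.2.2 := by
  have h1 : Primrec fun p : ℕ × List LEqn × LEqn => p.2.2.1 :=
    Primrec.fst.comp (Primrec.snd.comp Primrec.snd)
  have h2 : Primrec fun p : ℕ × List LEqn × LEqn => p.2.2.2 :=
    Primrec.snd.comp (Primrec.snd.comp Primrec.snd)
  exact Primrec.list_cons.comp
    (LEqn.primrec_le.comp (LTerm.primrec_var.comp Primrec.fst)
      (LTerm.primrec_sup.comp (LTerm.primrec_add.comp h1 (LTerm.primrec_neg.comp h2))
        (LTerm.primrec_add.comp h2 (LTerm.primrec_neg.comp h1))))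
    (Primrec.fst.comp Primrec.snd)

theorem primrecRel_decides : PrimrecRel Decides := by
  have hz : Primrec fun p : List LEqn × LEqn => freshVar (p.2 :: p.1) :=
    primrec_freshVar.comp (Primrec.list_cons.comp Primrec.snd Primrec.fst)
  have hN : Primrec fun p : List LEqn × LEqn => normalForms (freshVar (p.2 :: p.1))
      (project [freshVar (p.2 :: p.1)] (refutation (freshVar (p.2 :: p.1)) p.1 p.2)) :=
    primrec_normalForms.comp hz (primrec_project.comp
      (Primrec.list_cons.comp hz (Primrec.const []))
      (primrec_refutation.comp (hz.pair (Primrec.fst.pair Primrec.snd))))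
  have ht : PrimrecPred fun N : NormalSystem => ¬ N.t.length = 0 :=
    PrimrecPred.not
      (Primrec.eq.comp (Primrec.list_length.comp NormalSystem.primrec_t) (Primrec.const 0))
  exact PrimrecPred.comp (PrimrecPred.forall_mem_list ht) hN

/-! ### Totally ordered quotients of abelian ℓ-groups -/

section Representation

/-- A set of elements of an abelian ℓ-group that contains all nonnegative elements and is closed
under addition and meets: the elements that are nonnegative modulo an ℓ-ideal. -/
structure IsLatticeCone {L : Type*} [Lattice L] [AddCommGroup L] (C : Set L) : Prop where
  of_nonneg : ∀ a, 0 ≤ a → a ∈ C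
  add_mem : ∀ a ∈ C, ∀ b ∈ C, a + b ∈ C
  inf_mem : ∀ a ∈ C, ∀ b ∈ C, a ⊓ b ∈ C

variable {L : Type u} [Lattice L] [AddCommGroup L] [IsOrderedAddMonoid L]

theorem IsLatticeCone.mem_of_le {C : Set L} (hC : IsLatticeCone C) {a b : L} (ha : a ∈ C)
    (h : a ≤ b) : b ∈ C := by
  have := hC.add_mem a ha (b - a) (hC.of_nonneg _ (sub_nonneg.2 h))
  rwa [add_sub_cancel] at this

theorem inf_nsmul_nonpos (x : L) (n : ℕ) : n • (x ⊓ 0) ≤ 0 :=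
  nsmul_nonpos inf_le_right n

/-- The lattice cone generated by a lattice cone and an element `x`. -/
theorem IsLatticeCone.adjoin {C : Set L} (hC : IsLatticeCone C) (x : L) :
    IsLatticeCone {z | ∃ n : ℕ, ∃ c ∈ C, c + n • (x ⊓ 0) ≤ z} where
  of_nonneg a ha := ⟨0, 0, hC.of_nonneg 0 le_rfl, by simpa using ha⟩
  add_mem := by
    rintro a ⟨n, c, hc, h⟩ b ⟨m, d, hd, h'⟩
    refine ⟨n + m, c + d, hC.add_mem c hc d hd, ?_⟩
    calc c + d + (n + m) • (x ⊓ 0) = (c + n • (x ⊓ 0)) + (d + m • (x ⊓ 0)) := by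
          rw [add_nsmul]; abel
      _ ≤ a + b := add_le_add h h'
  inf_mem := by
    rintro a ⟨n, c, hc, h⟩ b ⟨m, d, hd, h'⟩
    -- The summands `n • (x ⊓ 0)` and `m • (x ⊓ 0)` are nonpositive, so passing to `n + m` only
    -- weakens both lower bounds.
    refine ⟨n + m, c ⊓ d, hC.inf_mem c hc d hd, le_inf (le_trans ?_ h) (le_trans ?_ h')⟩
    · rw [add_nsmul]
      exact add_le_add inf_le_left (add_le_of_nonpos_right (inf_nsmul_nonpos x m))
    · rw [add_nsmul]
      exact add_le_add inf_le_right (add_le_of_nonpos_left (inf_nsmul_nonpos x n))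

/-- Disjointness survives addition: `(a ⊔ c) + (b ⊔ c)` expands to the join of `a + b`, `a + c`, `c
+ b`, `c + c`, and for nonpositive elements each of these lies below `(a + b) ⊔ c`. Multiples follow
by induction, one side at a time. -/
theorem sup_nsmul_eq_zero {u w : L} (hu : u ≤ 0) (hw : w ≤ 0) (h : u ⊔ w = 0) (m n : ℕ) :
    m • u ⊔ n • w = 0 := by
  have key : ∀ {a b c : L}, a ≤ 0 → b ≤ 0 → c ≤ 0 → a ⊔ c = 0 → b ⊔ c = 0 → (a + b) ⊔ c = 0 := by
    intro a b c ha hb hc hac hbc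
    apply le_antisymm (sup_le (add_nonpos ha hb) hc)
    calc (0 : L) = (a ⊔ c) + (b ⊔ c) := by rw [hac, hbc, add_zero]
      _ ≤ (a + b) ⊔ c := by
        rw [add_sup, sup_add, sup_add]
        refine sup_le (sup_le le_sup_left ?_) (sup_le ?_ ?_)
        · exact le_trans (add_le_of_nonpos_right hb) le_sup_right
        · exact le_trans (add_le_of_nonpos_left ha) le_sup_right
        · exact le_trans (add_le_of_nonpos_left hc) le_sup_right
  have mul : ∀ {a c : L}, a ≤ 0 → c ≤ 0 → a ⊔ c = 0 → ∀ n : ℕ, n • a ⊔ c = 0 := by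
    intro a c ha hc hac n
    induction n with
    | zero => rw [zero_nsmul]; exact sup_eq_left.2 hc
    | succ n ih => rw [succ_nsmul]; exact key (nsmul_nonpos ha n) ha hc ih hac
  have h1 := mul hu hw h m
  rw [sup_comm] at h1 ⊢
  exact mul hw (nsmul_nonpos hu m) h1 n

/-- Zorn gives a maximal lattice cone `C` avoiding `a`. If `x` and `-x` were both outside `C`,
adjoining either would capture `a`, so `a` lies above `c + n(x ⊓ 0)` and above `d + m(-x ⊓ 0)` with
`c`, `d` in `C`. Since `(x ⊓ 0) ⊔ (-x ⊓ 0) = |x| ⊓ 0 = 0`, the multiples also join to 0; hence `c ⊓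
d ≤ a` and `a` would be in `C`. -/
theorem exists_total_latticeCone {a : L} (ha : ¬ 0 ≤ a) :
    ∃ C : Set L, IsLatticeCone C ∧ a ∉ C ∧ ∀ x, x ∈ C ∨ -x ∈ C := by
  obtain ⟨C, -, hmax⟩ := zorn_subset_nonempty {C : Set L | IsLatticeCone C ∧ a ∉ C} (by
    intro c hc hchain hne
    refine ⟨⋃₀ c, ⟨⟨?_, ?_, ?_⟩, ?_⟩, fun s hs => Set.subset_sUnion_of_mem hs⟩
    · obtain ⟨s, hs⟩ := hne
      exact fun b hb => ⟨s, hs, (hc hs).1.of_nonneg b hb⟩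
    · rintro b ⟨s, hs, hb⟩ d ⟨t, ht, hd⟩
      rcases hchain.total hs ht with hst | hst
      · exact ⟨t, ht, (hc ht).1.add_mem b (hst hb) d hd⟩
      · exact ⟨s, hs, (hc hs).1.add_mem b hb d (hst hd)⟩
    · rintro b ⟨s, hs, hb⟩ d ⟨t, ht, hd⟩
      rcases hchain.total hs ht with hst | hst
      · exact ⟨t, ht, (hc ht).1.inf_mem b (hst hb) d hd⟩
      · exact ⟨s, hs, (hc hs).1.inf_mem b hb d (hst hd)⟩
    · rintro ⟨s, hs, h⟩
      exact (hc hs).2 h) {x | 0 ≤ x}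
    ⟨⟨fun _ h => h, fun _ h _ h' => add_nonneg h h', fun _ h _ h' => le_inf h h'⟩, ha⟩
  obtain ⟨hC, haC⟩ := hmax.prop
  refine ⟨C, hC, haC, fun x => ?_⟩
  have adj : ∀ y, y ∉ C → ∃ n : ℕ, ∃ c ∈ C, c + n • (y ⊓ 0) ≤ a := by
    intro y hy
    by_contra hcon
    have hsub : C ⊆ {z | ∃ n : ℕ, ∃ c ∈ C, c + n • (y ⊓ 0) ≤ z} :=
      fun c hc => ⟨0, c, hc, by simp⟩
    exact hy (hmax.le_of_ge ⟨hC.adjoin y, hcon⟩ hsub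
      ⟨1, 0, hC.of_nonneg 0 le_rfl, by simp⟩)
  by_contra! hx
  obtain ⟨n, c, hc, h⟩ := adj x hx.1
  obtain ⟨m, d, hd, h'⟩ := adj (-x) hx.2
  refine haC (hC.mem_of_le (hC.inf_mem c hc d hd) ?_)
  have h0 : x ⊓ 0 ⊔ -x ⊓ 0 = 0 := by
    let _ : DistribLattice L := AddCommGroup.toDistribLattice L
    rw [← inf_sup_right]
    exact inf_eq_right.2 (abs_nonneg x)
  calc c ⊓ d = c ⊓ d + (n • (x ⊓ 0) ⊔ m • (-x ⊓ 0)) := by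
        rw [sup_nsmul_eq_zero inf_le_right inf_le_right h0, add_zero]
    _ ≤ a := by
      rw [add_sup]
      exact sup_le (le_trans (by gcongr; exact inf_le_left) h)
        (le_trans (by gcongr; exact inf_le_right) h')

/-- An element of an abelian ℓ-group that is not nonnegative has a negative image under some
homomorphism to a totally ordered abelian group. -/
theorem exists_linearOrder_quotient {a : L} (ha : ¬ 0 ≤ a) :
    ∃ (G : Type u) (_ : LinearOrder G) (_ : AddCommGroup G) (_ : IsOrderedAddMonoid G)
      (π : L →+ G), (∀ x y, π (x ⊓ y) = π x ⊓ π y) ∧ (∀ x y, π (x ⊔ y) = π x ⊔ π y) ∧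
        π a < 0 := by
  obtain ⟨C, hC, haC, htot⟩ := exists_total_latticeCone ha
  -- `P = C ∩ -C` is the kernel; the image of `C` in the quotient becomes the cone of nonnegative
  -- elements, and totality of `C` makes the order linear.
  let P : AddSubgroup L :=
    { carrier := {x | x ∈ C ∧ -x ∈ C}
      zero_mem' := ⟨hC.of_nonneg 0 le_rfl, by simpa using hC.of_nonneg 0 le_rfl⟩
      add_mem' := fun {x y} hx hy => ⟨hC.add_mem x hx.1 y hy.1, by
        rw [neg_add]; exact hC.add_mem _ hx.2 _ hy.2⟩
      neg_mem' := fun {x} hx => ⟨hx.2, by rw [neg_neg]; exact hx.1⟩ }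
  let π : L →+ L ⧸ P := QuotientAddGroup.mk' P
  have hker : ∀ x, π x = 0 ↔ x ∈ C ∧ -x ∈ C := fun x => QuotientAddGroup.eq_zero_iff x
  have hπ : ∀ x y, π x = π y → x ∈ C → y ∈ C := by
    intro x y hxy hx
    have h : π (y - x) = 0 := by rw [map_sub, hxy, sub_self]
    have := hC.add_mem x hx _ ((hker _).1 h).1
    rwa [add_sub_cancel] at this
  let K : AddGroupCone (L ⧸ P) :=
    { carrier := π '' C
      zero_mem' := ⟨0, hC.of_nonneg 0 le_rfl, map_zero π⟩
      add_mem' := by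
        rintro _ _ ⟨x, hx, rfl⟩ ⟨y, hy, rfl⟩
        exact ⟨x + y, hC.add_mem x hx y hy, map_add π x y⟩
      eq_zero_of_mem_of_neg_mem' := by
        rintro _ ⟨x, hx, rfl⟩ ⟨y, hy, h⟩
        exact (hker x).2 ⟨hx, hπ y (-x) (by rw [h, map_neg]) hy⟩ }
  have hK : ∀ x, π x ∈ K ↔ x ∈ C :=
    fun x => ⟨fun ⟨y, hy, h⟩ => hπ y x h hy, fun hx => ⟨x, hx, rfl⟩⟩
  have : HasMemOrNegMem K := ⟨fun g => by
    obtain ⟨x, rfl⟩ := QuotientAddGroup.mk'_surjective P g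
    exact (htot x).imp (hK x).2 fun h => (hK (-x)).2 h⟩
  classical
  let _ : LinearOrder (L ⧸ P) := LinearOrder.mkOfAddGroupCone K
  have hord : IsOrderedAddMonoid (L ⧸ P) := IsOrderedAddMonoid.mkOfCone K
  have hle : ∀ x y, π x ≤ π y ↔ y - x ∈ C := fun x y => hK (y - x)
  have hinf : ∀ x y, π (x ⊓ y) = π x ⊓ π y := by
    have mono : ∀ x y : L, x ≤ y → π x ≤ π y := fun x y h =>
      (hle x y).2 (hC.of_nonneg _ (sub_nonneg.2 h))
    intro x y
    refine le_antisymm (le_inf (mono _ _ inf_le_left) (mono _ _ inf_le_right)) ?_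
    -- If `y - x` is in `C`, the image of `x` is the smaller one, and `x ⊓ y - x = 0 ⊓ (y - x)` is
    -- in `C`. The other case is symmetric.
    rcases htot (y - x) with h | h
    · refine le_trans inf_le_left ((hle _ _).2 ?_)
      rw [inf_sub, sub_self]
      exact hC.inf_mem _ (hC.of_nonneg 0 le_rfl) _ h
    · refine le_trans inf_le_right ((hle _ _).2 ?_)
      rw [inf_sub, sub_self]
      exact hC.inf_mem _ (by rwa [neg_sub] at h) _ (hC.of_nonneg 0 le_rfl)
  refine ⟨L ⧸ P, inferInstance, inferInstance, hord, π, hinf, fun x y => ?_, ?_⟩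
  -- Joins come for free from meets, because `x ⊓ y + x ⊔ y = x + y`.
  · have h := congrArg π (inf_add_sup x y)
    rw [map_add, map_add, hinf, ← inf_add_sup (π x) (π y)] at h
    exact add_left_cancel h
  · rw [← not_le]
    intro h
    rw [← map_zero π, hle, sub_zero] at h
    exact haC h

end Representation

theorem LTerm.eval_hom {L G : Type*} [Lattice L] [AddCommGroup L] [Lattice G] [AddCommGroup G]
    (π : L →+ G) (hinf : ∀ x y, π (x ⊓ y) = π x ⊓ π y) (hsup : ∀ x y, π (x ⊔ y) = π x ⊔ π y)
    (v : ℕ → L) (t : LTerm) : t.eval (fun i => π (v i)) = π (t.eval v) := by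
  induction t with
  | var i => rfl
  | zero => exact (map_zero π).symm
  | neg a ha => simp only [eval, ha, map_neg]
  | add a b ha hb => simp only [eval, ha, hb, map_add]
  | inf a b ha hb => simp only [eval, ha, hb, hinf]
  | sup a b ha hb => simp only [eval, ha, hb, hsup]

/-- Consequence over all abelian ℓ-groups reduces to totally ordered abelian groups. -/
theorem entailsLA_of_linearOrder {Γ : List LEqn} {ε : LEqn}
    (h : ∀ (G : Type u) [LinearOrder G] [AddCommGroup G] [IsOrderedAddMonoid G],
      EntailsIn G Γ ε) : EntailsLA.{u} Γ ε := by
  intro L _ _ _ v hv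
  by_contra hne
  -- Every totally ordered quotient satisfies `Γ`, hence identifies the two sides of `ε`. An element
  -- killed by all such quotients must therefore be nonnegative; this is applied to both differences
  -- of the sides.
  have key : ∀ a : L, ¬ 0 ≤ a → (∀ (G : Type u) [LinearOrder G] [AddCommGroup G]
      [IsOrderedAddMonoid G] (π : L →+ G), π (ε.1.eval v) = π (ε.2.eval v) → π a = 0) → False := by
    intro a ha hπ
    obtain ⟨G, _, _, _, π, hinf, hsup, hlt⟩ := exists_linearOrder_quotient ha
    refine hlt.ne (hπ G π ?_)
    have := h G (fun i => π (v i)) fun e he => by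
      have h' := hv e he
      unfold LEqn.Holds at h' ⊢
      rw [LTerm.eval_hom π hinf hsup, LTerm.eval_hom π hinf hsup, h']
    unfold LEqn.Holds at this
    rwa [LTerm.eval_hom π hinf hsup, LTerm.eval_hom π hinf hsup] at this
  refine hne (le_antisymm ?_ ?_)
  · by_contra hle
    exact key (ε.2.eval v - ε.1.eval v) (by rwa [sub_nonneg])
      fun G _ _ _ π hπ => by rw [map_sub, hπ, sub_self]
  · by_contra hle
    exact key (ε.1.eval v - ε.2.eval v) (by rwa [sub_nonneg])
      fun G _ _ _ π hπ => by rw [map_sub, hπ, sub_self]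

/-! ### Variables -/

theorem LTerm.eval_congr {L : Type*} [Lattice L] [AddCommGroup L] {v w : ℕ → L} {t : LTerm}
    (h : ∀ i ∈ t.vars, v i = w i) : t.eval v = t.eval w := by
  induction t with
  | var i => exact h i (by simp [vars])
  | zero => rfl
  | neg a ha => simp only [eval, ha h]
  | add a b ha hb | inf a b ha hb | sup a b ha hb =>
    simp only [vars, Finset.mem_union] at h
    simp only [eval, ha fun i hi => h i (.inl hi), hb fun i hi => h i (.inr hi)]

theorem LEqn.holds_congr {L : Type*} [Lattice L] [AddCommGroup L] {v w : ℕ → L} {e : LEqn}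
    (h : ∀ i ∈ e.vars, v i = w i) : e.Holds v ↔ e.Holds w := by
  simp only [LEqn.vars, Finset.mem_union] at h
  unfold LEqn.Holds
  rw [LTerm.eval_congr fun i hi => h i (.inl hi), LTerm.eval_congr fun i hi => h i (.inr hi)]

theorem LTerm.mem_varList {t : LTerm} {i : ℕ} : i ∈ t.varList ↔ i ∈ t.vars := by
  induction t <;> simp_all [varList, fold, vars]

theorem LTerm.vars_nmul_subset (n : ℕ) (t : LTerm) : (nmul n t).vars ⊆ t.vars := by
  induction n with
  | zero => simp [nmul, vars]
  | succ n ih => exact Finset.union_subset ih subset_rfl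

theorem LTerm.eval_nmul {L : Type*} [Lattice L] [AddCommGroup L] (v : ℕ → L) (n : ℕ)
    (t : LTerm) : (nmul n t).eval v = n • t.eval v := by
  induction n with
  | zero => simp [nmul, eval]
  | succ n ih => simp [nmul, eval, ih, succ_nsmul]

theorem LTerm.eval_const_zero {L : Type*} [Lattice L] [AddCommGroup L] (t : LTerm) :
    t.eval (fun _ => (0 : L)) = 0 := by
  induction t <;> simp_all [eval]

theorem LTerm.eval_eq_zero {L : Type*} [Lattice L] [AddCommGroup L] {v : ℕ → L} {t : LTerm}
    (h : ∀ i ∈ t.vars, v i = 0) : t.eval v = 0 :=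
  (eval_congr h).trans (eval_const_zero t)

theorem mem_varsOf {Γ : List LEqn} {i : ℕ} : i ∈ varsOf Γ ↔ ∃ e ∈ Γ, i ∈ e.vars := by
  simp [varsOf, LEqn.vars, LTerm.mem_varList]

theorem lt_freshVar {Γ : List LEqn} {i : ℕ} (h : i ∈ varsOf Γ) : i < freshVar Γ := by
  unfold freshVar
  generalize varsOf Γ = l at h
  induction l with
  | nil => simp at h
  | cons a l ih =>
    rcases List.mem_cons.1 h with rfl | h
    · exact lt_of_lt_of_le (Nat.lt_succ_self i) (le_max_left _ _)
    · exact lt_of_lt_of_le (ih h) (le_max_right _ _)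

theorem mem_listDiff {l ys : List ℕ} {i : ℕ} : i ∈ listDiff l ys ↔ i ∈ l ∧ i ∉ ys := by
  simp only [listDiff, List.mem_filter, decide_eq_true_eq]
  exact and_congr_right fun _ => ⟨fun h hi => h i hi rfl, fun h y hy hyi => h (hyi ▸ hy)⟩

/-- All variables of the linear form other than `x` are in `Y`. -/
def LinForm.IsOver (Y : Set ℕ) (k : LinForm) : Prop := (k.2.2.vars : Set ℕ) ⊆ Y

theorem LinForm.IsOver.neg {Y : Set ℕ} {k : LinForm} (h : k.IsOver Y) : (neg k).IsOver Y := h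

theorem LinForm.IsOver.add {Y : Set ℕ} {k l : LinForm} (hk : k.IsOver Y) (hl : l.IsOver Y) :
    (add k l).IsOver Y := by
  simpa [IsOver, LinForm.add, LTerm.vars] using ⟨hk, hl⟩

theorem LinForm.IsOver.sub {Y : Set ℕ} {k l : LinForm} (hk : k.IsOver Y) (hl : l.IsOver Y) :
    (sub k l).IsOver Y := hk.add hl.neg

/-- All variables of the branch other than `x` are in `Y`. -/
def Branch.IsOver (Y : Set ℕ) (b : Branch) : Prop := (∀ k ∈ b.1, k.IsOver Y) ∧ b.2.IsOver Y

theorem Branch.IsOver.conditions {Y : Set ℕ} {a b : Branch} (ha : a.IsOver Y) (hb : b.IsOver Y) :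
    ∀ k ∈ a.1 ++ b.1, k.IsOver Y :=
  List.forall_mem_append.2 ⟨ha.1, hb.1⟩

theorem Branch.isOver_combine {Y : Set ℕ} {h : Branch → Branch → List Branch} {A B : List Branch}
    (hA : ∀ a ∈ A, a.IsOver Y) (hB : ∀ b ∈ B, b.IsOver Y)
    (H : ∀ a b : Branch, a.IsOver Y → b.IsOver Y → ∀ c ∈ h a b, c.IsOver Y) :
    ∀ c ∈ combine h A B, c.IsOver Y := by
  intro c hc
  simp only [combine, List.mem_flatMap] at hc
  obtain ⟨a, ha, b, hb, hc⟩ := hc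
  exact H a b (hA a ha) (hB b hb) c hc

theorem LTerm.branches_isOver {x : ℕ} {Y : Set ℕ} {t : LTerm} (ht : ∀ i ∈ t.vars, i ≠ x → i ∈ Y) :
    ∀ b ∈ t.branches x, b.IsOver Y := by
  induction t with
  | var i =>
    intro b hb
    by_cases hi : i = x
    · simp only [branches, fold, Branch.ofVar, if_pos hi, List.mem_singleton] at hb
      subst hb
      simp [Branch.IsOver, LinForm.IsOver, vars]
    · simp only [branches, fold, Branch.ofVar, if_neg hi, List.mem_singleton] at hb
      subst hb
      simpa [Branch.IsOver, LinForm.IsOver, vars] using ht i (by simp [vars]) hi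
  | zero => simp [branches, fold, Branch.IsOver, LinForm.IsOver, vars]
  | neg a ha =>
    intro b hb
    obtain ⟨c, hc, rfl⟩ := List.mem_map.1 hb
    exact ha ht c hc
  | add a b ha hb =>
    simp only [vars, Finset.mem_union] at ht
    refine Branch.isOver_combine (ha fun i hi => ht i (.inl hi)) (hb fun i hi => ht i (.inr hi)) ?_
    intro c d hc hd e he
    obtain rfl := List.mem_singleton.1 he
    exact ⟨hc.conditions hd, hc.2.add hd.2⟩
  | inf a b ha hb =>
    simp only [vars, Finset.mem_union] at ht
    refine Branch.isOver_combine (ha fun i hi => ht i (.inl hi)) (hb fun i hi => ht i (.inr hi)) ?_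
    intro c d hc hd e he
    simp only [Branch.inf, List.mem_cons, List.not_mem_nil, or_false] at he
    rcases he with rfl | rfl
    · exact ⟨List.forall_mem_cons.2 ⟨hd.2.sub hc.2, hc.conditions hd⟩, hc.2⟩
    · exact ⟨List.forall_mem_cons.2 ⟨hc.2.sub hd.2, hc.conditions hd⟩, hd.2⟩
  | sup a b ha hb =>
    simp only [vars, Finset.mem_union] at ht
    refine Branch.isOver_combine (ha fun i hi => ht i (.inl hi)) (hb fun i hi => ht i (.inr hi)) ?_
    intro c d hc hd e he
    simp only [Branch.sup, List.mem_cons, List.not_mem_nil, or_false] at he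
    rcases he with rfl | rfl
    · exact ⟨List.forall_mem_cons.2 ⟨hc.2.sub hd.2, hc.conditions hd⟩, hc.2⟩
    · exact ⟨List.forall_mem_cons.2 ⟨hd.2.sub hc.2, hc.conditions hd⟩, hd.2⟩

theorem LEqn.systems_isOver {x : ℕ} {Y : Set ℕ} {e : LEqn} (he : ∀ i ∈ e.vars, i ≠ x → i ∈ Y) :
    ∀ c ∈ e.systems x, ∀ k ∈ c, k.IsOver Y := by
  intro c hc
  simp only [LEqn.vars, Finset.mem_union] at he
  simp only [systems, List.mem_flatMap, List.mem_map] at hc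
  obtain ⟨a, ha, b, hb, rfl⟩ := hc
  have ha := LTerm.branches_isOver (fun i hi => he i (.inl hi)) a ha
  have hb := LTerm.branches_isOver (fun i hi => he i (.inr hi)) b hb
  exact List.forall_mem_cons.2 ⟨ha.2.sub hb.2,
    List.forall_mem_cons.2 ⟨hb.2.sub ha.2, ha.conditions hb⟩⟩

theorem linearSystems_isOver {x : ℕ} {Y : Set ℕ} {Γ : List LEqn}
    (h : ∀ e ∈ Γ, ∀ i ∈ e.vars, i ≠ x → i ∈ Y) :
    ∀ c ∈ linearSystems x Γ, ∀ k ∈ c, k.IsOver Y := by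
  induction Γ with
  | nil => simp [linearSystems]
  | cons e Γ ih =>
    intro c hc
    simp only [linearSystems, List.foldr_cons, List.mem_flatMap, List.mem_map] at hc
    obtain ⟨c, hc, d, hd, rfl⟩ := hc
    rw [List.forall_mem_cons] at h
    exact List.forall_mem_append.2 ⟨LEqn.systems_isOver h.1 c hc, ih h.2 d hd⟩

/-! ### Common coefficients, and the variables of eliminated systems -/

theorem LinForm.one_le_coeff (k : LinForm) : 1 ≤ k.coeff := le_max_left _ _

theorem one_le_commonCoeff (c : List LinForm) : 1 ≤ commonCoeff c := by
  induction c with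
  | nil => exact le_rfl
  | cons k c ih => exact Nat.mul_pos k.one_le_coeff ih

theorem coeff_dvd_commonCoeff {c : List LinForm} {k : LinForm} (hk : k ∈ c) :
    k.coeff ∣ commonCoeff c := by
  induction c with
  | nil => simp at hk
  | cons l c ih =>
    rcases List.mem_cons.1 hk with rfl | hk
    · exact dvd_mul_right _ _
    · exact (ih hk).trans (dvd_mul_left _ _)

theorem normalizeSystem_isOver {Y : Set ℕ} {c : List LinForm} (h : ∀ k ∈ c, k.IsOver Y) :
    (normalizeSystem c).IsOver Y := by
  refine ⟨one_le_commonCoeff c, ?_, ?_, ?_⟩ <;>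
  · intro a ha
    obtain ⟨k, hk, rfl⟩ := List.mem_map.1 ha
    have hk := h k (List.mem_of_mem_filter hk)
    first
    | exact hk
    | exact (Finset.coe_subset.2 (LTerm.vars_nmul_subset _ _)).trans hk

theorem normalForms_isOver (x : ℕ) (Γ : List LEqn) :
    ∀ N ∈ normalForms x Γ, N.IsOver {y | y ≠ x ∧ ∃ e ∈ Γ, y ∈ e.vars} := by
  intro N hN
  obtain ⟨c, hc, rfl⟩ := List.mem_map.1 hN
  exact normalizeSystem_isOver
    (linearSystems_isOver (Y := {y | y ≠ x ∧ ∃ e ∈ Γ, y ∈ e.vars})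
      (fun e he i hi hix => ⟨hix, e, he, hi⟩) c hc)

theorem NormalSystem.elimTerms_vars {N : NormalSystem} {Y : Set ℕ} (h : N.IsOver Y) :
    ∀ a ∈ N.elimTerms, (a.vars : Set ℕ) ⊆ Y := by
  intro a ha
  simp only [elimTerms, List.mem_append, List.mem_flatMap, List.mem_map] at ha
  rcases ha with ⟨s, hs, t, ht, rfl⟩ | ha
  · simp only [LTerm.vars, Finset.coe_union, Set.union_subset_iff]
    exact ⟨h.2.1 s hs, h.2.2.1 t ht⟩
  · exact h.2.2.2 a ha

theorem infList_vars {Y : Set ℕ} {l : List LTerm} (h : ∀ a ∈ l, (a.vars : Set ℕ) ⊆ Y) :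
    ((infList l).vars : Set ℕ) ⊆ Y := by
  induction l with
  | nil => simp [infList, LTerm.vars]
  | cons a l ih =>
    rw [List.forall_mem_cons] at h
    simpa [infList, LTerm.vars] using ⟨h.1, ih h.2⟩

theorem supList_vars {Y : Set ℕ} {l : List LTerm} (h : ∀ a ∈ l, (a.vars : Set ℕ) ⊆ Y) :
    ((supList l).vars : Set ℕ) ⊆ Y := by
  have key : ∀ b : LTerm, (b.vars : Set ℕ) ⊆ Y → ((l.foldr .sup b).vars : Set ℕ) ⊆ Y := by
    intro b hb
    induction l with
    | nil => exact hb
    | cons a l ih =>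
      rw [List.forall_mem_cons] at h
      simpa [LTerm.vars] using ⟨h.1, ih h.2⟩
  refine key _ ?_
  cases l with
  | nil => simp [LTerm.vars]
  | cons a l => exact h a (by simp)

theorem elimTerm_vars (x : ℕ) (Γ : List LEqn) :
    ((elimTerm x Γ).vars : Set ℕ) ⊆ {y | y ≠ x ∧ ∃ e ∈ Γ, y ∈ e.vars} := by
  refine supList_vars fun a ha => ?_
  obtain ⟨N, hN, rfl⟩ := List.mem_map.1 ha
  exact infList_vars (NormalSystem.elimTerms_vars (normalForms_isOver x Γ N hN))

theorem elimVar_vars {x : ℕ} {Γ : List LEqn} {e : LEqn} (he : e ∈ elimVar x Γ) {i : ℕ}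
    (hi : i ∈ e.vars) : i ≠ x ∧ ∃ e ∈ Γ, i ∈ e.vars := by
  obtain rfl := List.mem_singleton.1 he
  exact elimTerm_vars x Γ (by simpa [LEqn.vars, LEqn.le, LTerm.vars] using hi)

theorem elimVars_vars {xs : List ℕ} {Γ : List LEqn} {e : LEqn} (he : e ∈ elimVars xs Γ) {i : ℕ}
    (hi : i ∈ e.vars) : i ∉ xs ∧ ∃ e ∈ Γ, i ∈ e.vars := by
  induction xs generalizing Γ with
  | nil => exact ⟨List.not_mem_nil, e, he, hi⟩
  | cons x xs ih =>
    obtain ⟨h1, e', he', hi'⟩ := ih (Γ := elimVar x Γ) he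
    obtain ⟨h2, h3⟩ := elimVar_vars he' hi'
    exact ⟨by simp [h1, h2], h3⟩

theorem project_vars {ys : List ℕ} {Γ : List LEqn} {e : LEqn} (he : e ∈ project ys Γ) {i : ℕ}
    (hi : i ∈ e.vars) : i ∈ ys := by
  obtain ⟨h, h'⟩ := elimVars_vars he hi
  by_contra hy
  exact h (mem_listDiff.2 ⟨mem_varsOf.2 h', hy⟩)

/-! ### Semantics of the elimination procedure -/

theorem LEqn.holds_le {L : Type*} [Lattice L] [AddCommGroup L] (v : ℕ → L) (s t : LTerm) :
    (LEqn.le s t).Holds v ↔ s.eval v ≤ t.eval v :=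
  inf_eq_left

theorem NormalSystem.holds_eqns {L : Type*} [Lattice L] [AddCommGroup L] (N : NormalSystem)
    (x : ℕ) (v : ℕ → L) :
    (∀ e ∈ N.eqns x, e.Holds v) ↔ (∀ a ∈ N.s, 0 ≤ a.eval v + N.n • v x) ∧
      (∀ a ∈ N.t, 0 ≤ a.eval v + -(N.n • v x)) ∧ ∀ a ∈ N.u, 0 ≤ a.eval v := by
  simp only [eqns, List.forall_mem_append, List.forall_mem_map, LEqn.holds_le, LTerm.eval,
    LTerm.eval_nmul, and_assoc]

theorem NormalSystem.elim_eq (N : NormalSystem) :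
    N.elim = N.elimTerms.map fun a => LEqn.le .zero a := by
  simp [elim, elimTerms, List.map_flatMap, Function.comp_def]

theorem NormalSystem.holds_elim {L : Type*} [Lattice L] [AddCommGroup L] (N : NormalSystem)
    (v : ℕ → L) : (∀ e ∈ N.elim, e.Holds v) ↔
      (∀ a ∈ N.s, ∀ b ∈ N.t, 0 ≤ a.eval v + b.eval v) ∧ ∀ a ∈ N.u, 0 ≤ a.eval v := by
  simp only [elim, List.forall_mem_append, List.forall_mem_map, List.forall_mem_flatMap,
    LEqn.holds_le, LTerm.eval]

/-- Elimination is sound in every abelian ℓ-group. -/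
theorem NormalSystem.holds_elim_of_holds_eqns {L : Type*} [Lattice L] [AddCommGroup L]
    [IsOrderedAddMonoid L] {N : NormalSystem} {x : ℕ} {v : ℕ → L}
    (h : ∀ e ∈ N.eqns x, e.Holds v) : ∀ e ∈ N.elim, e.Holds v := by
  rw [holds_eqns] at h
  rw [holds_elim]
  refine ⟨fun a ha b hb => ?_, h.2.2⟩
  have := add_nonneg (h.1 a ha) (h.2.1 b hb)
  rwa [add_add_add_comm, add_neg_cancel, add_zero] at this

/-- The induction covers empty lists, for which one side imposes no bound: start from a lower bound
of `B` and raise it to the maximum with each member of `A`. -/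
theorem exists_between_lists (A B : List ℝ) (h : ∀ a ∈ A, ∀ b ∈ B, a ≤ b) :
    ∃ c, (∀ a ∈ A, a ≤ c) ∧ ∀ b ∈ B, c ≤ b := by
  induction A with
  | nil =>
    obtain ⟨c, hc⟩ := B.finite_toSet.bddBelow
    exact ⟨c, by simp, fun b hb => hc hb⟩
  | cons a A ih =>
    rw [List.forall_mem_cons] at h
    obtain ⟨c, hA, hB⟩ := ih h.2
    refine ⟨max a c, List.forall_mem_cons.2 ⟨le_max_left _ _, fun d hd => ?_⟩, fun b hb => ?_⟩
    · exact (hA d hd).trans (le_max_right _ _)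
    · exact max_le (h.1 b hb) (hB b hb)

/-- Elimination is complete over the real numbers. -/
theorem NormalSystem.exists_holds_eqns {N : NormalSystem} {x : ℕ} (hN : N.IsOver {x}ᶜ)
    {v : ℕ → ℝ} (h : ∀ e ∈ N.elim, e.Holds v) :
    ∃ r : ℝ, ∀ e ∈ N.eqns x, e.Holds (Function.update v x r) := by
  obtain ⟨hst, hu⟩ := (holds_elim N v).1 h
  obtain ⟨c, hs, ht⟩ := exists_between_lists (N.s.map fun a => -a.eval v)
    (N.t.map fun a => a.eval v) (by
      simp only [List.forall_mem_map]
      intro a ha b hb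
      linarith [hst a ha b hb])
  simp only [List.forall_mem_map] at hs ht
  have hn : (N.n : ℝ) ≠ 0 := by
    have := hN.1
    positivity
  have heval : ∀ a : LTerm, (a.vars : Set ℕ) ⊆ {x}ᶜ → ∀ r : ℝ,
      a.eval (Function.update v x r) = a.eval v := fun a ha r =>
    LTerm.eval_congr fun i hi => Function.update_of_ne (ha hi) _ _
  -- The separating value `c` is one for `n x`; dividing by `n` is where divisibility of `ℝ` enters.
  -- In `ℤ` the conditions `0 ≤ -y + 2x`, `0 ≤ y - 2x` have no solution `x` for `y = 1`, although
  -- elimination yields a valid inequality.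
  refine ⟨c / N.n, (holds_eqns N x _).2 ⟨fun a ha => ?_, fun a ha => ?_, fun a ha => ?_⟩⟩
  · rw [heval a (hN.2.1 a ha), Function.update_self, nsmul_eq_mul, mul_div_cancel₀ _ hn]
    linarith [hs a ha]
  · rw [heval a (hN.2.2.1 a ha), Function.update_self, nsmul_eq_mul, mul_div_cancel₀ _ hn]
    linarith [ht a ha]
  · rw [heval a (hN.2.2.2 a ha)]
    exact hu a ha

/-! ### Normal forms and soundness of elimination over totally ordered groups -/

section Linear

variable {G : Type*} [LinearOrder G] [AddCommGroup G]

/-- The value of a linear form. -/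
def LinForm.eval (x : ℕ) (v : ℕ → G) (k : LinForm) : G :=
  k.1 • v x - k.2.1 • v x + k.2.2.eval v

/-- All linear forms of the list are nonnegative. -/
def Satisfies (x : ℕ) (v : ℕ → G) (c : List LinForm) : Prop := ∀ k ∈ c, 0 ≤ k.eval x v

theorem satisfies_append {x : ℕ} {v : ℕ → G} {c d : List LinForm} :
    Satisfies x v (c ++ d) ↔ Satisfies x v c ∧ Satisfies x v d := List.forall_mem_append

theorem satisfies_cons {x : ℕ} {v : ℕ → G} {k : LinForm} {d : List LinForm} :
    Satisfies x v (k :: d) ↔ 0 ≤ k.eval x v ∧ Satisfies x v d := List.forall_mem_cons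

theorem satisfies_nil {x : ℕ} {v : ℕ → G} : Satisfies x v [] := by simp [Satisfies]

theorem LinForm.eval_neg (x : ℕ) (v : ℕ → G) (k : LinForm) :
    (LinForm.neg k).eval x v = -k.eval x v := by
  simp only [LinForm.eval, LinForm.neg, LTerm.eval]; abel

theorem LinForm.eval_add (x : ℕ) (v : ℕ → G) (k l : LinForm) :
    (LinForm.add k l).eval x v = k.eval x v + l.eval x v := by
  simp only [LinForm.eval, LinForm.add, LTerm.eval, add_nsmul]; abel

/-- The branches describe the value `g`: some branch applies, and those that apply have the
value `g`. -/
def Covers (x : ℕ) (v : ℕ → G) (B : List Branch) (g : G) : Prop :=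
  (∃ b ∈ B, Satisfies x v b.1) ∧ ∀ b ∈ B, Satisfies x v b.1 → b.2.eval x v = g

/-- Common core of the binary connectives: some child of two applicable branches applies (`H`), and
a child applies only where both parents do, with the right value there (`H'`). -/
theorem Covers.combine {x : ℕ} {v : ℕ → G} {h : Branch → Branch → List Branch}
    {A B : List Branch} {g₁ g₂ g : G} (hA : Covers x v A g₁) (hB : Covers x v B g₂)
    (H : ∀ a b : Branch, Satisfies x v a.1 → Satisfies x v b.1 → ∃ c ∈ h a b, Satisfies x v c.1)
    (H' : ∀ a b : Branch, ∀ c ∈ h a b, Satisfies x v c.1 → (Satisfies x v a.1 ∧ Satisfies x v b.1) ∧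
      (a.2.eval x v = g₁ → b.2.eval x v = g₂ → c.2.eval x v = g)) :
    Covers x v (Branch.combine h A B) g := by
  constructor
  · obtain ⟨a, ha, hsa⟩ := hA.1
    obtain ⟨b, hb, hsb⟩ := hB.1
    obtain ⟨c, hc, hsc⟩ := H a b hsa hsb
    exact ⟨c, List.mem_flatMap.2 ⟨a, ha, List.mem_flatMap.2 ⟨b, hb, hc⟩⟩, hsc⟩
  · intro c hc hsc
    obtain ⟨a, ha, hc⟩ := List.mem_flatMap.1 hc
    obtain ⟨b, hb, hc⟩ := List.mem_flatMap.1 hc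
    obtain ⟨⟨hsa, hsb⟩, heq⟩ := H' a b c hc hsc
    exact heq (hA.2 a ha hsa) (hB.2 b hb hsb)

theorem eval_infList_nonneg (v : ℕ → G) (l : List LTerm) :
    0 ≤ (infList l).eval v ↔ ∀ a ∈ l, 0 ≤ a.eval v := by
  induction l with
  | nil => simp [infList, LTerm.eval]
  | cons a l ih =>
    rw [List.forall_mem_cons, ← ih]
    exact le_inf_iff

/-- Totality of the order turns `0 ≤ a ⊔ b` into a disjunction. The fold starts from the head of the
list and so adds no new candidate; the empty list is excluded because its join would be the term 0.
-/
theorem eval_supList_nonneg (v : ℕ → G) {l : List LTerm} (hl : l ≠ []) :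
    0 ≤ (supList l).eval v ↔ ∃ a ∈ l, 0 ≤ a.eval v := by
  have key : ∀ b : LTerm, 0 ≤ (l.foldr .sup b).eval v ↔ 0 ≤ b.eval v ∨ ∃ a ∈ l, 0 ≤ a.eval v := by
    intro b
    clear hl
    induction l with
    | nil => simp
    | cons a l ih =>
      simp only [List.foldr_cons, LTerm.eval, le_sup_iff, ih, List.exists_mem_cons_iff]
      tauto
  obtain ⟨a, l, rfl⟩ := List.exists_cons_of_ne_nil hl
  exact (key a).trans (or_iff_right_of_imp fun h => ⟨a, by simp, h⟩)

variable [IsOrderedAddMonoid G]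

theorem LinForm.eval_sub_nonneg (x : ℕ) (v : ℕ → G) (k l : LinForm) :
    0 ≤ (LinForm.sub k l).eval x v ↔ l.eval x v ≤ k.eval x v := by
  rw [LinForm.sub, eval_add, eval_neg, ← sub_eq_add_neg, sub_nonneg]

/-- Induction on the term. At a meet or join the values of two applicable forms are comparable, so
one of the two new branches applies; at a tie both apply and agree. -/
theorem LTerm.branches_covers (x : ℕ) (v : ℕ → G) (t : LTerm) :
    Covers x v (t.branches x) (t.eval v) := by
  induction t with
  | var i =>
    by_cases hi : i = x
    · simp [Covers, branches, fold, Branch.ofVar, hi, satisfies_nil, LinForm.eval, eval]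
    · simp [Covers, branches, fold, Branch.ofVar, hi, satisfies_nil, LinForm.eval, eval]
  | zero => simp [Covers, branches, fold, satisfies_nil, LinForm.eval, eval]
  | neg a ha =>
    constructor
    · obtain ⟨b, hb, hs⟩ := ha.1
      exact ⟨Branch.neg b, List.mem_map_of_mem hb, hs⟩
    · intro b hb hs
      obtain ⟨c, hc, rfl⟩ := List.mem_map.1 hb
      simp only [Branch.neg, LinForm.eval_neg, eval, ha.2 c hc hs]
  | add a b ha hb =>
    refine ha.combine hb (fun c d hc hd => ?_) fun c d e he hs => ?_
    · exact ⟨_, List.mem_singleton_self _, satisfies_append.2 ⟨hc, hd⟩⟩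
    · obtain rfl := List.mem_singleton.1 he
      refine ⟨satisfies_append.1 hs, fun h1 h2 => ?_⟩
      simp only [LinForm.eval_add, h1, h2, eval]
  | inf a b ha hb =>
    refine ha.combine hb (fun c d hc hd => ?_) fun c d e he hs => ?_
    · rcases le_total (c.2.eval x v) (d.2.eval x v) with h | h
      · exact ⟨_, List.mem_cons_self, satisfies_cons.2
          ⟨(LinForm.eval_sub_nonneg x v _ _).2 h, satisfies_append.2 ⟨hc, hd⟩⟩⟩
      · exact ⟨_, List.mem_cons_of_mem _ List.mem_cons_self, satisfies_cons.2
          ⟨(LinForm.eval_sub_nonneg x v _ _).2 h, satisfies_append.2 ⟨hc, hd⟩⟩⟩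
    · simp only [Branch.inf, List.mem_cons, List.not_mem_nil, or_false] at he
      rcases he with rfl | rfl <;> rw [satisfies_cons, LinForm.eval_sub_nonneg] at hs <;>
        refine ⟨satisfies_append.1 hs.2, fun h1 h2 => ?_⟩ <;> rw [h1, h2] at hs
      · rw [h1, eval, inf_eq_left.2 hs.1]
      · rw [h2, eval, inf_eq_right.2 hs.1]
  | sup a b ha hb =>
    refine ha.combine hb (fun c d hc hd => ?_) fun c d e he hs => ?_
    · rcases le_total (d.2.eval x v) (c.2.eval x v) with h | h
      · exact ⟨_, List.mem_cons_self, satisfies_cons.2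
          ⟨(LinForm.eval_sub_nonneg x v _ _).2 h, satisfies_append.2 ⟨hc, hd⟩⟩⟩
      · exact ⟨_, List.mem_cons_of_mem _ List.mem_cons_self, satisfies_cons.2
          ⟨(LinForm.eval_sub_nonneg x v _ _).2 h, satisfies_append.2 ⟨hc, hd⟩⟩⟩
    · simp only [Branch.sup, List.mem_cons, List.not_mem_nil, or_false] at he
      rcases he with rfl | rfl <;> rw [satisfies_cons, LinForm.eval_sub_nonneg] at hs <;>
        refine ⟨satisfies_append.1 hs.2, fun h1 h2 => ?_⟩ <;> rw [h1, h2] at hs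
      · rw [h1, eval, sup_eq_left.2 hs.1]
      · rw [h2, eval, sup_eq_right.2 hs.1]

theorem LEqn.holds_iff_systems (x : ℕ) (v : ℕ → G) (e : LEqn) :
    e.Holds v ↔ ∃ c ∈ e.systems x, Satisfies x v c := by
  obtain ⟨⟨a, ha, hsa⟩, ha'⟩ := LTerm.branches_covers x v e.1
  obtain ⟨⟨b, hb, hsb⟩, hb'⟩ := LTerm.branches_covers x v e.2
  constructor
  · intro he
    have hab : a.2.eval x v = b.2.eval x v := by rw [ha' a ha hsa, hb' b hb hsb]; exact he
    refine ⟨_, List.mem_flatMap.2 ⟨a, ha, List.mem_map_of_mem hb⟩, ?_⟩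
    rw [satisfies_cons, satisfies_cons, satisfies_append, LinForm.eval_sub_nonneg,
      LinForm.eval_sub_nonneg]
    exact ⟨hab.ge, hab.le, hsa, hsb⟩
  · rintro ⟨c, hc, hs⟩
    obtain ⟨a, ha, hc⟩ := List.mem_flatMap.1 hc
    obtain ⟨b, hb, rfl⟩ := List.mem_map.1 hc
    rw [satisfies_cons, satisfies_cons, satisfies_append, LinForm.eval_sub_nonneg,
      LinForm.eval_sub_nonneg] at hs
    unfold LEqn.Holds
    rw [← ha' a ha hs.2.2.1, ← hb' b hb hs.2.2.2]
    exact le_antisymm hs.2.1 hs.1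

theorem holds_iff_linearSystems (x : ℕ) (v : ℕ → G) (Γ : List LEqn) :
    (∀ e ∈ Γ, e.Holds v) ↔ ∃ c ∈ linearSystems x Γ, Satisfies x v c := by
  induction Γ with
  | nil => simp [linearSystems, satisfies_nil]
  | cons e Γ ih =>
    rw [List.forall_mem_cons, ih, LEqn.holds_iff_systems x]
    simp only [linearSystems, List.foldr_cons, List.mem_flatMap, List.mem_map]
    constructor
    · rintro ⟨⟨c, hc, hsc⟩, d, hd, hsd⟩
      exact ⟨c ++ d, ⟨c, hc, d, hd, rfl⟩, satisfies_append.2 ⟨hsc, hsd⟩⟩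
    · rintro ⟨_, ⟨c, hc, d, hd, rfl⟩, hs⟩
      obtain ⟨hsc, hsd⟩ := satisfies_append.1 hs
      exact ⟨⟨c, hc, hsc⟩, d, hd, hsd⟩

/-- The scaled inequality is the original one multiplied by the positive integer `n / k.coeff`, and
multiplication by a positive integer reflects nonnegativity in a totally ordered group. -/
theorem LinForm.nonneg_of_lt {x : ℕ} {v : ℕ → G} {k : LinForm} {n : ℕ} (hn : 1 ≤ n)
    (hk : k.coeff ∣ n) (hlt : k.2.1 < k.1) :
    0 ≤ (LTerm.nmul (n / k.coeff) k.2.2).eval v + n • v x ↔ 0 ≤ k.eval x v := by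
  have hc : k.coeff = k.1 - k.2.1 := by unfold coeff; omega
  have h0 : n / k.coeff ≠ 0 := (Nat.div_pos (Nat.le_of_dvd hn hk) k.one_le_coeff).ne'
  have h : (LTerm.nmul (n / k.coeff) k.2.2).eval v + n • v x = (n / k.coeff) • k.eval x v := by
    rw [LTerm.eval_nmul, LinForm.eval, sub_eq_add_neg, ← sub_nsmul _ hlt.le, ← hc, nsmul_add, smul_smul,
      Nat.div_mul_cancel hk, add_comm]
  rw [h, nsmul_nonneg_iff h0]

theorem LinForm.nonneg_of_gt {x : ℕ} {v : ℕ → G} {k : LinForm} {n : ℕ} (hn : 1 ≤ n)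
    (hk : k.coeff ∣ n) (hlt : k.1 < k.2.1) :
    0 ≤ (LTerm.nmul (n / k.coeff) k.2.2).eval v + -(n • v x) ↔ 0 ≤ k.eval x v := by
  have hc : k.coeff = k.2.1 - k.1 := by unfold coeff; omega
  have h0 : n / k.coeff ≠ 0 := (Nat.div_pos (Nat.le_of_dvd hn hk) k.one_le_coeff).ne'
  have h : (LTerm.nmul (n / k.coeff) k.2.2).eval v + -(n • v x) = (n / k.coeff) • k.eval x v := by
    rw [LTerm.eval_nmul, LinForm.eval, ← neg_sub (k.2.1 • v x),
      sub_eq_add_neg (k.2.1 • v x), ← sub_nsmul _ hlt.le, ← hc, nsmul_add, smul_neg, smul_smul, Nat.div_mul_cancel hk, add_comm]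
  rw [h, nsmul_nonneg_iff h0]

theorem holds_normalizeSystem (x : ℕ) (v : ℕ → G) (c : List LinForm) :
    (∀ e ∈ (normalizeSystem c).eqns x, e.Holds v) ↔ Satisfies x v c := by
  have hn := one_le_commonCoeff c
  rw [NormalSystem.holds_eqns]
  simp only [normalizeSystem, List.forall_mem_map, List.mem_filter, decide_eq_true_eq]
  constructor
  · rintro ⟨hs, ht, hu⟩ k hk
    rcases lt_trichotomy k.1 k.2.1 with h | h | h
    · exact (LinForm.nonneg_of_gt hn (coeff_dvd_commonCoeff hk) h).1 (ht k ⟨hk, h⟩)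
    · have := hu k ⟨hk, h⟩
      rwa [LinForm.eval, h, sub_self, zero_add]
    · exact (LinForm.nonneg_of_lt hn (coeff_dvd_commonCoeff hk) h).1 (hs k ⟨hk, h⟩)
  · intro hc
    refine ⟨fun k ⟨hk, h⟩ => ?_, fun k ⟨hk, h⟩ => ?_, fun k ⟨hk, h⟩ => ?_⟩
    · exact (LinForm.nonneg_of_lt hn (coeff_dvd_commonCoeff hk) h).2 (hc k hk)
    · exact (LinForm.nonneg_of_gt hn (coeff_dvd_commonCoeff hk) h).2 (hc k hk)
    · have := hc k hk
      rwa [LinForm.eval, h, sub_self, zero_add] at this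

theorem holds_iff_normalForms (x : ℕ) (v : ℕ → G) (Γ : List LEqn) :
    (∀ e ∈ Γ, e.Holds v) ↔ ∃ N ∈ normalForms x Γ, ∀ e ∈ N.eqns x, e.Holds v := by
  rw [holds_iff_linearSystems x]
  simp only [normalForms, List.mem_map, exists_exists_and_eq_and, holds_normalizeSystem]

/-- The zero assignment satisfies every system of equations, so at least one disjunct must be
present. -/
theorem normalForms_ne_nil (x : ℕ) (Γ : List LEqn) : normalForms x Γ ≠ [] := by
  obtain ⟨N, hN, -⟩ := (holds_iff_normalForms x (fun _ => (0 : ℝ)) Γ).1 fun e _ => by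
    unfold LEqn.Holds
    rw [LTerm.eval_const_zero, LTerm.eval_const_zero]
  exact List.ne_nil_of_mem hN

/-- Meets encode the conjunction inside each eliminated system, joins the disjunction over the
systems; this returns a case distinction to a single inequality. -/
theorem elimTerm_nonneg_iff {G : Type*} [LinearOrder G] [AddCommGroup G]
    (x : ℕ) (v : ℕ → G) (Γ : List LEqn) :
    0 ≤ (elimTerm x Γ).eval v ↔ ∃ N ∈ normalForms x Γ, ∀ e ∈ N.elim, e.Holds v := by
  rw [elimTerm, eval_supList_nonneg v (by simpa using normalForms_ne_nil x Γ)]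
  have key : ∀ N : NormalSystem,
      (∀ e ∈ N.elim, e.Holds v) ↔ ∀ a ∈ N.elimTerms, 0 ≤ a.eval v := fun N => by
    rw [NormalSystem.elim_eq, List.forall_mem_map]
    simp only [LEqn.holds_le, LTerm.eval]
  simp only [List.mem_map, exists_exists_and_eq_and, eval_infList_nonneg, key]

theorem holds_elimVar_iff {G : Type*} [LinearOrder G] [AddCommGroup G]
    (x : ℕ) (v : ℕ → G) (Γ : List LEqn) :
    (∀ e ∈ elimVar x Γ, e.Holds v) ↔ ∃ N ∈ normalForms x Γ, ∀ e ∈ N.elim, e.Holds v := by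
  rw [← elimTerm_nonneg_iff]
  simp only [elimVar, List.mem_singleton, forall_eq, LEqn.holds_le, LTerm.eval]

theorem holds_elimVar {x : ℕ} {v : ℕ → G} {Γ : List LEqn} (h : ∀ e ∈ Γ, e.Holds v) :
    ∀ e ∈ elimVar x Γ, e.Holds v := by
  obtain ⟨N, hN, h⟩ := (holds_iff_normalForms x v Γ).1 h
  exact (holds_elimVar_iff x v Γ).2 ⟨N, hN, NormalSystem.holds_elim_of_holds_eqns h⟩

theorem holds_elimVars {xs : List ℕ} {v : ℕ → G} {Γ : List LEqn} (h : ∀ e ∈ Γ, e.Holds v) :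
    ∀ e ∈ elimVars xs Γ, e.Holds v := by
  induction xs generalizing Γ with
  | nil => exact h
  | cons x xs ih => exact ih (holds_elimVar h)

end Linear

/-! ### Lifting real solutions back through elimination -/

theorem NormalSystem.IsOver.mono {N : NormalSystem} {Y Z : Set ℕ} (h : N.IsOver Y) (hYZ : Y ⊆ Z) :
    N.IsOver Z :=
  ⟨h.1, fun a ha => (h.2.1 a ha).trans hYZ, fun a ha => (h.2.2.1 a ha).trans hYZ,
    fun a ha => (h.2.2.2 a ha).trans hYZ⟩

theorem exists_holds_of_elimVar {x : ℕ} {v : ℕ → ℝ} {Γ : List LEqn}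
    (h : ∀ e ∈ elimVar x Γ, e.Holds v) : ∃ r, ∀ e ∈ Γ, e.Holds (Function.update v x r) := by
  obtain ⟨N, hN, h⟩ := (holds_elimVar_iff x v Γ).1 h
  obtain ⟨r, hr⟩ := NormalSystem.exists_holds_eqns
    ((normalForms_isOver x Γ N hN).mono fun y hy => hy.1) h
  exact ⟨r, (holds_iff_normalForms x _ Γ).2 ⟨N, hN, hr⟩⟩

theorem exists_holds_of_elimVars {xs : List ℕ} {v : ℕ → ℝ} {Γ : List LEqn}
    (h : ∀ e ∈ elimVars xs Γ, e.Holds v) :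
    ∃ w : ℕ → ℝ, (∀ i, i ∉ xs → w i = v i) ∧ ∀ e ∈ Γ, e.Holds w := by
  induction xs generalizing Γ with
  | nil => exact ⟨v, fun _ _ => rfl, h⟩
  | cons x xs ih =>
    obtain ⟨w, hw, hΓ⟩ := ih (Γ := elimVar x Γ) h
    obtain ⟨r, hr⟩ := exists_holds_of_elimVar hΓ
    refine ⟨Function.update w x r, fun i hi => ?_, hr⟩
    rw [List.mem_cons, not_or] at hi
    rw [Function.update_of_ne hi.1, hw i hi.2]

/-- Over the real numbers, `elimVars xs Γ` has the consequences of `Γ` without the variables `xs`. -/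
theorem entailsIn_real_elimVars {xs : List ℕ} {Γ : List LEqn} {ε : LEqn}
    (hε : ∀ i ∈ xs, i ∉ ε.vars) : EntailsIn ℝ Γ ε ↔ EntailsIn ℝ (elimVars xs Γ) ε := by
  constructor
  · intro h v hv
    obtain ⟨w, hw, hΓ⟩ := exists_holds_of_elimVars hv
    exact (LEqn.holds_congr fun i hi => hw i fun hx => hε i hx hi).1 (h w hΓ)
  · exact fun h v hv => h v (holds_elimVars hv)

/-! ### Consequence is decidable and determined by the real numbers -/

/-- A normal form without upper bounds on `z` admits `z = 1`. Completeness of elimination over `ℝ`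
extends this to an assignment satisfying `Γ` at which the sides of `ε` differ by at least 1. -/
theorem not_entailsIn_real_of_not_decides {Γ : List LEqn} {ε : LEqn} (h : ¬ Decides Γ ε) :
    ¬ EntailsIn ℝ Γ ε := by
  simp only [Decides, not_forall, not_not] at h
  obtain ⟨N, hN, ht⟩ := h
  set z := freshVar (ε :: Γ) with hz
  have hover : N.IsOver ∅ := (normalForms_isOver _ _ N hN).mono fun y ⟨hy, e, he, hye⟩ =>
    hy (List.mem_singleton.1 (project_vars he hye))
  -- The terms of `N` have no variables left, so their value is 0 under any assignment.
  have h0 : ∀ a : LTerm, (a.vars : Set ℕ) ⊆ ∅ → a.eval (fun _ => (1 : ℝ)) = 0 :=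
    fun a ha => LTerm.eval_eq_zero fun i hi => (ha hi).elim
  have hproj := (holds_iff_normalForms z (fun _ => (1 : ℝ)) (project [z] (refutation z Γ ε))).2
    ⟨N, hN, (NormalSystem.holds_eqns N z _).2 ⟨fun a ha => by
      rw [h0 a (hover.2.1 a ha), zero_add, nsmul_one]; exact Nat.cast_nonneg _,
      fun a ha => by simp [List.length_eq_zero_iff.1 ht] at ha,
      fun a ha => (h0 a (hover.2.2.2 a ha)).ge⟩⟩
  obtain ⟨w, hw, hR⟩ := exists_holds_of_elimVars hproj
  have hwz : w z = 1 := hw z fun hmem => (mem_listDiff.1 hmem).2 (by simp)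
  rw [refutation, List.forall_mem_cons, LEqn.holds_le] at hR
  intro hent
  have hε := hent w hR.2
  unfold LEqn.Holds at hε
  simp only [LTerm.eval, hwz, hε, add_neg_cancel, sup_idem] at hR
  linarith [hR.1]

/-- Only soundness of elimination is used, so `G` need not be divisible: a counterexample gives `z`
the positive value `|a - b|`, but every normal form of the projection contains a condition amounting
to `0 ≤ -(n z)`. -/
theorem entailsIn_of_decides {G : Type*} [LinearOrder G] [AddCommGroup G] [IsOrderedAddMonoid G]
    {Γ : List LEqn} {ε : LEqn} (h : Decides Γ ε) : EntailsIn G Γ ε := by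
  intro v hv
  by_contra hne
  unfold Decides at h
  set z := freshVar (ε :: Γ) with hz
  let d : G := |ε.1.eval v - ε.2.eval v|
  have hd : 0 < d := abs_pos.2 (sub_ne_zero.2 hne)
  let w : ℕ → G := Function.update v z d
  have hfresh : ∀ e ∈ ε :: Γ, ∀ i ∈ e.vars, v i = w i := fun e he i hi =>
    (Function.update_of_ne (lt_freshVar (mem_varsOf.2 ⟨e, he, hi⟩)).ne _ _).symm
  have hε := hfresh ε (by simp)
  simp only [LEqn.vars, Finset.mem_union] at hε
  have hR : ∀ e ∈ refutation z Γ ε, e.Holds w := by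
    refine List.forall_mem_cons.2 ⟨(LEqn.holds_le _ _ _).2 ?_, fun e he =>
      (LEqn.holds_congr (hfresh e (List.mem_cons_of_mem _ he))).1 (hv e he)⟩
    simp only [LTerm.eval]
    rw [← LTerm.eval_congr fun i hi => hε i (.inl hi), ← LTerm.eval_congr fun i hi => hε i (.inr hi),
      ← sub_eq_add_neg, ← sub_eq_add_neg]
    refine le_of_eq ?_
    rw [← neg_sub (ε.1.eval v) (ε.2.eval v)]
    exact Function.update_self _ _ _
  obtain ⟨N, hN, hNw⟩ := (holds_iff_normalForms z w _).1
    (holds_elimVars (xs := listDiff (varsOf (refutation z Γ ε)) [z]) hR)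
  have hover : N.IsOver ∅ := (normalForms_isOver _ _ N hN).mono fun y ⟨hy, e, he, hye⟩ =>
    hy (List.mem_singleton.1 (project_vars he hye))
  obtain ⟨b, hb⟩ := List.exists_mem_of_ne_nil N.t fun ht => h N hN (by rw [ht]; rfl)
  have := ((NormalSystem.holds_eqns N z w).1 hNw).2.1 b hb
  rw [LTerm.eval_eq_zero fun i hi => (hover.2.2.1 b hb hi).elim, zero_add, neg_nonneg,
    show w z = d from Function.update_self _ _ _] at this
  exact absurd this (nsmul_pos hd (by have := hover.1; omega)).not_ge

theorem entailsIn_real_iff_decides {Γ : List LEqn} {ε : LEqn} :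
    EntailsIn ℝ Γ ε ↔ Decides Γ ε :=
  ⟨fun h => by_contra fun hd => not_entailsIn_real_of_not_decides hd h, entailsIn_of_decides⟩

/-- The copy `ULift ℝ` is needed because the ℓ-groups range over an arbitrary universe. -/
theorem entailsIn_real_of_entailsLA {Γ : List LEqn} {ε : LEqn} (h : EntailsLA.{u} Γ ε) :
    EntailsIn ℝ Γ ε := by
  have hord : IsOrderedAddMonoid (ULift.{u} ℝ) :=
    { add_le_add_left := fun a b hab c => add_le_add_left (α := ℝ) hab c.down }
  intro v hv
  let π : ℝ →+ ULift.{u} ℝ := (AddEquiv.ulift (α := ℝ)).symm.toAddMonoidHom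
  have hπ : ∀ t : LTerm, t.eval (fun i => π (v i)) = π (t.eval v) :=
    LTerm.eval_hom π (fun _ _ => rfl) (fun _ _ => rfl) v
  have := h (ULift.{u} ℝ) (fun i => π (v i)) fun e he => by
    unfold LEqn.Holds
    rw [hπ, hπ, hv e he]
  unfold LEqn.Holds at this
  rw [hπ, hπ] at this
  exact (AddEquiv.ulift (α := ℝ)).symm.injective this

/-- The consequences of a finite set of equations in the variety of abelian ℓ-groups are those in
the real numbers. -/
theorem entailsLA_iff_real {Γ : List LEqn} {ε : LEqn} : EntailsLA.{u} Γ ε ↔ EntailsIn ℝ Γ ε :=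
  ⟨entailsIn_real_of_entailsLA, fun h => entailsLA_of_linearOrder fun _ _ _ _ =>
    entailsIn_of_decides (entailsIn_real_iff_decides.1 h)⟩

/-! ### Dependence -/

theorem LTerm.eval_subst {L : Type*} [Lattice L] [AddCommGroup L] (f : ℕ → LTerm) (v : ℕ → L)
    (t : LTerm) : (t.subst f).eval v = t.eval fun i => (f i).eval v := by
  induction t <;> simp_all [subst, eval]

theorem LEqn.holds_subst {L : Type*} [Lattice L] [AddCommGroup L] (f : ℕ → LTerm) (v : ℕ → L)
    (e : LEqn) : (e.subst f).Holds v ↔ e.Holds fun i => (f i).eval v := by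
  simp only [Holds, subst, LTerm.eval_subst]

theorem LTerm.exists_of_mem_vars_subst {f : ℕ → LTerm} {t : LTerm} {i : ℕ}
    (h : i ∈ (t.subst f).vars) : ∃ j ∈ t.vars, i ∈ (f j).vars := by
  induction t with
  | var j => exact ⟨j, by simp [vars], h⟩
  | zero => simp [subst, vars] at h
  | neg a ha => exact ha h
  | add a b ha hb | inf a b ha hb | sup a b ha hb =>
    simp only [subst, vars, Finset.mem_union] at h ⊢
    rcases h with h | h
    · obtain ⟨j, hj, hi⟩ := ha h
      exact ⟨j, .inl hj, hi⟩
    · obtain ⟨j, hj, hi⟩ := hb h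
      exact ⟨j, .inr hj, hi⟩

theorem LEqn.exists_of_mem_vars_subst {f : ℕ → LTerm} {e : LEqn} {i : ℕ}
    (h : i ∈ (e.subst f).vars) : ∃ j ∈ e.vars, i ∈ (f j).vars := by
  simp only [LEqn.vars, LEqn.subst, Finset.mem_union] at h ⊢
  rcases h with h | h
  · obtain ⟨j, hj, hi⟩ := LTerm.exists_of_mem_vars_subst h
    exact ⟨j, .inl hj, hi⟩
  · obtain ⟨j, hj, hi⟩ := LTerm.exists_of_mem_vars_subst h
    exact ⟨j, .inr hj, hi⟩

/-- A number larger than all variables of the equations and terms. -/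
def freshVarFor (Γ : List LEqn) (ts : List LTerm) : ℕ := freshVar (Γ ++ ts.map fun t => (t, t))

/-- The equations `Γ` together with equations that name the terms of `ts` by the variables
`z, z + 1, …`. -/
def nameTerms (z : ℕ) (Γ : List LEqn) (ts : List LTerm) : List LEqn :=
  Γ ++ (List.range ts.length).map fun i => (ts.getD i .zero, .var (z + i))

/-- The relations between the terms `ts` that follow from `Γ`, as equations between the variables
`z, z + 1, …` where `z` is fresh. -/
def relations (Γ : List LEqn) (ts : List LTerm) : List LEqn :=
  project ((List.range ts.length).map fun i => freshVarFor Γ ts + i)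
    (nameTerms (freshVarFor Γ ts) Γ ts)

theorem primrec_relations : Primrec₂ relations := by
  have hz : Primrec fun p : List LEqn × List LTerm => freshVarFor p.1 p.2 :=
    primrec_freshVar.comp (Primrec.list_append.comp Primrec.fst
      (Primrec.list_map Primrec.snd (Primrec.snd.pair Primrec.snd).to₂))
  have hr : Primrec fun p : List LEqn × List LTerm => List.range p.2.length :=
    Primrec.list_range.comp (Primrec.list_length.comp Primrec.snd)
  have hzi : Primrec₂ fun (p : List LEqn × List LTerm) (i : ℕ) => freshVarFor p.1 p.2 + i :=
    Primrec.nat_add.comp (hz.comp Primrec.fst) Primrec.snd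
  exact primrec_project.comp (Primrec.list_map hr hzi)
    (Primrec.list_append.comp Primrec.fst (Primrec.list_map hr
      (Primrec.pair ((Primrec.list_getD _).comp (Primrec.snd.comp Primrec.fst) Primrec.snd)
        (LTerm.primrec_var.comp hzi)).to₂))

/-- If all equations of the projection are valid, any values of the names extend to a real model of
`Γ` in which the terms take these values, so every relation entailed between the terms is valid.
Conversely, an invalid equation of the projection is itself a witness of dependence. -/
theorem dependentOver_iff (Γ : List LEqn) (ts : List LTerm) :
    DependentOver.{u} Γ ts ↔ ∃ e ∈ relations Γ ts, ¬ Decides [] e := by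
  simp only [DependentOver, entailsLA_iff_real, ← entailsIn_real_iff_decides, relations]
  set z := freshVarFor Γ ts with hz
  have hmem : ∀ i, i < ts.length → ts.getD i .zero ∈ ts := fun i hi => by
    rw [List.getD_eq_getElem _ _ hi]; exact List.getElem_mem hi
  have hfΓ : ∀ e ∈ Γ, ∀ i ∈ e.vars, i < z := fun e he i hi =>
    lt_freshVar (mem_varsOf.2 ⟨e, List.mem_append_left _ he, hi⟩)
  have hft : ∀ t ∈ ts, ∀ i ∈ t.vars, i < z := fun t ht i hi =>
    lt_freshVar (mem_varsOf.2 ⟨(t, t), List.mem_append_right _ (List.mem_map_of_mem ht),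
      Finset.mem_union_left _ hi⟩)
  constructor
  · rintro ⟨ε, hεv, hent, hinv⟩
    by_contra! hall
    refine hinv fun v _ => ?_
    -- The shift by `z` gives the name `z + i` the prescribed value of `y_i`.
    obtain ⟨w, hw, hΔ⟩ := exists_holds_of_elimVars (v := fun j => v (j - z))
      fun e he => hall e he (fun j => v (j - z)) (by simp)
    rw [nameTerms, List.forall_mem_append, List.forall_mem_map] at hΔ
    refine (LEqn.holds_congr fun i hi => ?_).1 ((LEqn.holds_subst _ _ _).1 (hent w hΔ.1))
    have hi := hεv hi
    rw [Finset.mem_range] at hi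
    refine (hΔ.2 i (List.mem_range.2 hi)).trans ((hw (z + i) fun h => ?_).trans ?_)
    · exact (mem_listDiff.1 h).2 (List.mem_map.2 ⟨i, List.mem_range.2 hi, rfl⟩)
    · simp
  · rintro ⟨π, hπ, hinv⟩
    have hvars : ∀ j ∈ π.vars, ∃ i < ts.length, z + i = j := fun j hj => by
      simpa using project_vars hπ hj
    refine ⟨π.subst fun j => .var (j - z), fun i hi => ?_, fun v hv => ?_, fun hval => ?_⟩
    · obtain ⟨j, hj, hij⟩ := LEqn.exists_of_mem_vars_subst hi
      obtain ⟨k, hk, rfl⟩ := hvars j hj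
      simp only [LTerm.vars, Finset.mem_singleton] at hij
      rw [Finset.mem_range]
      omega
    -- Below `z`, where all variables of `Γ` and the terms lie, `w` is the given assignment; at `z +
    -- i` it takes the value of the `i`-th term, so the naming equations hold.
    · let w : ℕ → ℝ := fun j => if j < z then v j else (ts.getD (j - z) .zero).eval v
      have hwv : ∀ j, j < z → w j = v j := fun j hj => if_pos hj
      have hwz : ∀ i, w (z + i) = (ts.getD i .zero).eval v := fun i => by simp [w]
      have hΔ : ∀ e ∈ nameTerms z Γ ts, e.Holds w := by
        rw [nameTerms, List.forall_mem_append, List.forall_mem_map]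
        refine ⟨fun e he => (LEqn.holds_congr fun i hi => hwv i (hfΓ e he i hi)).2 (hv e he),
          fun i hi => ?_⟩
        refine Eq.trans (LTerm.eval_congr fun j hj => hwv j ?_) (hwz i).symm
        exact hft _ (hmem i (List.mem_range.1 hi)) j hj
      rw [LEqn.holds_subst, LEqn.holds_subst]
      refine (LEqn.holds_congr fun j hj => ?_).1 (holds_elimVars hΔ π hπ)
      obtain ⟨i, hi, rfl⟩ := hvars j hj
      rw [hwz, LTerm.eval, Nat.add_sub_cancel_left]
    · refine hinv fun v _ => ?_
      have := (LEqn.holds_subst _ _ _).1 (hval (fun i => v (z + i)) (by simp))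
      refine (LEqn.holds_congr fun j hj => ?_).1 this
      obtain ⟨i, hi, rfl⟩ := hvars j hj
      rw [LTerm.eval, Nat.add_sub_cancel_left]

theorem computablePred_dependentOver :
    ComputablePred fun p : List LEqn × List LTerm => DependentOver.{u} p.1 p.2 := by
  have h : PrimrecPred fun e : LEqn => ¬ Decides [] e :=
    PrimrecPred.not (primrecRel_decides.comp (Primrec.const []) Primrec.id)
  obtain ⟨inst, hp⟩ := ((PrimrecPred.exists_mem_list h).comp primrec_relations).of_eq
    fun p : List LEqn × List LTerm => (dependentOver_iff.{u} p.1 p.2).symm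
  exact ⟨inst, hp.to_comp⟩

/-! ### A single normalized system with the same consequences -/

/-- A term whose value is the least value of the terms of a nonempty list. -/
def minList (l : List LTerm) : LTerm := l.foldr .inf (l.head?.getD .zero)

/-- A common multiple of the coefficients of `x` in a list of normalized systems. -/
def commonMultiple (Ns : List NormalSystem) : ℕ := Ns.foldr (fun N m => N.n * m) 1

/-- The weakest of the bounds that the systems `Ns` impose on a multiple of `x`, where `f` selects
the lower or the upper bounds; there is none if some system does not impose a bound. -/
def weakestBound (f : NormalSystem → List LTerm) (Ns : List NormalSystem) : List LTerm :=
  if ∀ N ∈ Ns, ¬ (f N).length = 0 then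
    [supList (Ns.map fun N => .nmul (commonMultiple Ns / N.n) (minList (f N)))] else []

/-- The normalized system with the weakest of the bounds on `x` in the normal forms of `Γ` and the
condition that `Γ` is satisfied by some choice of a value for `x`. -/
def consequenceSystem (x : ℕ) (Γ : List LEqn) : NormalSystem where
  n := commonMultiple (normalForms x Γ)
  s := weakestBound NormalSystem.s (normalForms x Γ)
  t := weakestBound NormalSystem.t (normalForms x Γ)
  u := [elimTerm x Γ]

theorem primrec_minList : Primrec minList :=
  Primrec.list_foldr Primrec.id
    (Primrec.option_getD.comp Primrec.list_head? (Primrec.const _)) (LTerm.primrec_inf.comp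
      (Primrec.fst.comp Primrec.snd) (Primrec.snd.comp Primrec.snd)).to₂

theorem primrec_commonMultiple : Primrec commonMultiple :=
  Primrec.list_foldr Primrec.id (Primrec.const 1)
    (Primrec.nat_mul.comp (NormalSystem.primrec_n.comp (Primrec.fst.comp Primrec.snd))
      (Primrec.snd.comp Primrec.snd)).to₂

theorem primrec_weakestBound {f : NormalSystem → List LTerm} (hf : Primrec f) :
    Primrec (weakestBound f) := by
  have h : PrimrecPred fun N : NormalSystem => ¬ (f N).length = 0 :=
    PrimrecPred.not (Primrec.eq.comp (Primrec.list_length.comp hf) (Primrec.const 0))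
  exact Primrec.ite (PrimrecPred.forall_mem_list h)
    (Primrec.list_cons.comp
      (primrec_supList.comp (Primrec.list_map Primrec.id (LTerm.primrec_nmul.comp
        (Primrec.nat_div.comp (primrec_commonMultiple.comp Primrec.fst)
          (NormalSystem.primrec_n.comp Primrec.snd))
        (primrec_minList.comp (hf.comp Primrec.snd))).to₂))
      (Primrec.const []))
    (Primrec.const [])

theorem primrec_consequenceSystem : Primrec₂ consequenceSystem :=
  NormalSystem.primrec_mk (primrec_commonMultiple.comp primrec_normalForms)
    ((primrec_weakestBound NormalSystem.primrec_s).comp primrec_normalForms)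
    ((primrec_weakestBound NormalSystem.primrec_t).comp primrec_normalForms)
    (Primrec.list_cons.comp primrec_elimTerm (Primrec.const []))

theorem minList_vars {Y : Set ℕ} {l : List LTerm} (h : ∀ a ∈ l, (a.vars : Set ℕ) ⊆ Y) :
    ((minList l).vars : Set ℕ) ⊆ Y := by
  have key : ∀ b : LTerm, (b.vars : Set ℕ) ⊆ Y → ((l.foldr .inf b).vars : Set ℕ) ⊆ Y := by
    intro b hb
    induction l with
    | nil => exact hb
    | cons a l ih =>
      rw [List.forall_mem_cons] at h
      simpa [LTerm.vars] using ⟨h.1, ih h.2⟩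
  refine key _ ?_
  cases l with
  | nil => simp [LTerm.vars]
  | cons a l => exact h a (by simp)

theorem weakestBound_vars {Y : Set ℕ} {f : NormalSystem → List LTerm} {Ns : List NormalSystem}
    (h : ∀ N ∈ Ns, ∀ a ∈ f N, (a.vars : Set ℕ) ⊆ Y) :
    ∀ a ∈ weakestBound f Ns, (a.vars : Set ℕ) ⊆ Y := by
  intro a ha
  unfold weakestBound at ha
  split_ifs at ha
  · obtain rfl := List.mem_singleton.1 ha
    refine supList_vars fun b hb => ?_
    obtain ⟨N, hN, rfl⟩ := List.mem_map.1 hb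
    exact (Finset.coe_subset.2 (LTerm.vars_nmul_subset _ _)).trans (minList_vars (h N hN))
  · simp at ha

theorem dvd_commonMultiple {Ns : List NormalSystem} {N : NormalSystem} (hN : N ∈ Ns) :
    N.n ∣ commonMultiple Ns := by
  induction Ns with
  | nil => simp at hN
  | cons M Ns ih =>
    rcases List.mem_cons.1 hN with rfl | hN
    · exact dvd_mul_right _ _
    · exact (ih hN).trans (dvd_mul_left _ _)

theorem one_le_commonMultiple {Ns : List NormalSystem} (h : ∀ N ∈ Ns, 1 ≤ N.n) :
    1 ≤ commonMultiple Ns := by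
  induction Ns with
  | nil => exact le_rfl
  | cons M Ns ih =>
    rw [List.forall_mem_cons] at h
    exact Nat.mul_pos h.1 (ih h.2)

theorem consequenceSystem_isOver (x : ℕ) (Γ : List LEqn) :
    (consequenceSystem x Γ).IsOver {y | y ≠ x ∧ ∃ e ∈ Γ, y ∈ e.vars} := by
  have h := normalForms_isOver x Γ
  refine ⟨one_le_commonMultiple fun N hN => (h N hN).1,
    weakestBound_vars fun N hN => (h N hN).2.1,
    weakestBound_vars fun N hN => (h N hN).2.2.1, fun a ha => ?_⟩
  obtain rfl := List.mem_singleton.1 ha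
  exact elimTerm_vars x Γ

/-! ### Validity of the weakest bounds -/

section Bounds

variable {G : Type*} [LinearOrder G] [AddCommGroup G]

theorem exists_eval_minList (v : ℕ → G) {l : List LTerm} (hl : l ≠ []) :
    ∃ a ∈ l, (minList l).eval v = a.eval v := by
  have key : ∀ b : LTerm, (l.foldr .inf b).eval v = b.eval v ∨
      ∃ a ∈ l, (l.foldr .inf b).eval v = a.eval v := by
    intro b
    clear hl
    induction l with
    | nil => exact .inl rfl
    | cons a l ih =>
      rcases min_choice (a.eval v) ((l.foldr .inf b).eval v) with h | h
      · exact .inr ⟨a, by simp, h⟩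
      · exact ih.imp h.trans fun ⟨c, hc, h'⟩ => ⟨c, List.mem_cons_of_mem _ hc, h.trans h'⟩
  obtain ⟨a, l, rfl⟩ := List.exists_cons_of_ne_nil hl
  exact (key a).elim (fun h => ⟨a, by simp, h⟩) id

theorem eval_le_supList (v : ℕ → G) {l : List LTerm} {a : LTerm} (ha : a ∈ l) :
    a.eval v ≤ (supList l).eval v := by
  unfold supList
  generalize l.head?.getD .zero = b
  induction l with
  | nil => simp at ha
  | cons c l ih =>
    rcases List.mem_cons.1 ha with rfl | ha
    · exact le_sup_left
    · exact (ih ha).trans le_sup_right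

/-- An assignment satisfying one system `N` satisfies its strictest bound, attained at some `b`.
Scaling to the common multiple and passing to the larger join over all systems preserves it. The
element `g` is left free to serve both `x` and `-x`. -/
theorem weakestBound_nonneg [IsOrderedAddMonoid G] {f : NormalSystem → List LTerm}
    {Ns : List NormalSystem} {N : NormalSystem} (hN : N ∈ Ns) {v : ℕ → G} {g : G}
    (h : ∀ a ∈ f N, 0 ≤ a.eval v + N.n • g) :
    ∀ a ∈ weakestBound f Ns, 0 ≤ a.eval v + commonMultiple Ns • g := by
  intro a ha
  unfold weakestBound at ha
  split_ifs at ha with hne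
  · obtain rfl := List.mem_singleton.1 ha
    obtain ⟨b, hb, hmin⟩ := exists_eval_minList v (l := f N) fun h0 => hne N hN (by rw [h0]; rfl)
    have hle := eval_le_supList v
      (List.mem_map_of_mem (f := fun N => .nmul (commonMultiple Ns / N.n) (minList (f N))) hN)
    rw [LTerm.eval_nmul, hmin] at hle
    refine le_trans ?_ (add_le_add_left hle _)
    have := nsmul_nonneg (h b hb) (commonMultiple Ns / N.n)
    rwa [nsmul_add, smul_smul, Nat.div_mul_cancel (dvd_commonMultiple hN)] at this
  · simp at ha

theorem holds_consequenceSystem [IsOrderedAddMonoid G] {x : ℕ} {Γ : List LEqn} {v : ℕ → G}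
    (h : ∀ e ∈ Γ, e.Holds v) : ∀ e ∈ (consequenceSystem x Γ).eqns x, e.Holds v := by
  obtain ⟨N, hN, hv⟩ := (holds_iff_normalForms x v Γ).1 h
  have hN' := (NormalSystem.holds_eqns N x v).1 hv
  refine (NormalSystem.holds_eqns _ x v).2 ⟨weakestBound_nonneg hN hN'.1, ?_, fun a ha => ?_⟩
  · simp only [← smul_neg] at hN' ⊢
    exact weakestBound_nonneg hN hN'.2.1
  · obtain rfl := List.mem_singleton.1 ha
    exact (elimTerm_nonneg_iff x v Γ).2 ⟨N, hN, NormalSystem.holds_elim_of_holds_eqns hv⟩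

end Bounds

/-- The single condition `0 ≤ elimTerm x Γ` already carries all consequences without `x`; the bounds
on `x` need only follow from `Γ`. -/
theorem entailsIn_real_consequenceSystem {x : ℕ} {Γ : List LEqn} {ε : LEqn} (hε : x ∉ ε.vars) :
    EntailsIn ℝ Γ ε ↔ EntailsIn ℝ ((consequenceSystem x Γ).eqns x) ε := by
  refine ⟨fun h v hv => ?_, fun h v hv => h v (holds_consequenceSystem hv)⟩
  refine (entailsIn_real_elimVars (xs := [x]) fun i hi => ?_).1 h v ?_
  · rwa [List.mem_singleton.1 hi]
  · exact (holds_elimVar_iff x v Γ).2 ((elimTerm_nonneg_iff x v Γ).1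
      (((NormalSystem.holds_eqns _ x v).1 hv).2.2 _ (List.mem_singleton_self _)))

/-! ### The main theorem -/

theorem mainTheorem9 :
    -- dependence over finite sets of equations is decidable (the equations are part of the input)
    ComputablePred (fun p : List LEqn × List LTerm => DependentOver.{u} p.1 p.2) ∧
    -- the coherence problem is solved by an algorithm
    (∃ P : List ℕ × List LEqn → List LEqn, Computable P ∧
      ∀ (ys : List ℕ) (Γ : List LEqn),
        (∀ e ∈ P (ys, Γ), e.vars ⊆ ys.toFinset) ∧
        ∀ ε : LEqn, ε.vars ⊆ ys.toFinset → (EntailsLA.{u} Γ ε ↔ EntailsLA.{u} (P (ys, Γ)) ε)) ∧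
    -- normalization in one variable `x`, with the same consequences not involving `x`
    (∃ F : ℕ × List LEqn → NormalSystem, Computable F ∧
      ∀ (x : ℕ) (Γ : List LEqn),
        (F (x, Γ)).IsOver {y | y ≠ x ∧ ∃ e ∈ Γ, y ∈ e.vars} ∧
        ∀ ε : LEqn, x ∉ ε.vars →
          (EntailsLA.{u} Γ ε ↔ EntailsLA.{u} ((F (x, Γ)).eqns x) ε)) ∧
    -- normalization with the same solutions in `ℝ`, by a finite case distinction
    (∃ F : ℕ × List LEqn → List NormalSystem, Computable F ∧
      ∀ (x : ℕ) (Γ : List LEqn),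
        (∀ N ∈ F (x, Γ), N.IsOver {y | y ≠ x ∧ ∃ e ∈ Γ, y ∈ e.vars}) ∧
        ∀ v : ℕ → ℝ, (∀ e ∈ Γ, e.Holds v) ↔ ∃ N ∈ F (x, Γ), ∀ e ∈ N.eqns x, e.Holds v) ∧
    -- elimination of `x` from a normalized system
    (∀ (x : ℕ) (N : NormalSystem), N.IsOver {x}ᶜ →
      ∀ ε : LEqn, x ∉ ε.vars →
        (EntailsIn ℝ (N.eqns x) ε ↔ EntailsIn ℝ N.elim ε) ∧
        (EntailsLA.{u} (N.eqns x) ε ↔ EntailsLA.{u} N.elim ε)) := by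
  refine ⟨computablePred_dependentOver, ⟨fun p => project p.1 p.2, primrec_project.to_comp,
    fun ys Γ => ⟨fun e he i hi => List.mem_toFinset.2 (project_vars he hi), fun ε hε => ?_⟩⟩,
    ⟨fun p => consequenceSystem p.1 p.2, primrec_consequenceSystem.to_comp,
      fun x Γ => ⟨consequenceSystem_isOver x Γ, fun ε hε => ?_⟩⟩,
    ⟨fun p => normalForms p.1 p.2, primrec_normalForms.to_comp,
      fun x Γ => ⟨normalForms_isOver x Γ, fun v => holds_iff_normalForms x v Γ⟩⟩, ?_⟩
  · rw [entailsLA_iff_real, entailsLA_iff_real]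
    exact entailsIn_real_elimVars fun i hi hiε =>
      (mem_listDiff.1 hi).2 (List.mem_toFinset.1 (hε hiε))
  · rw [entailsLA_iff_real, entailsLA_iff_real]
    exact entailsIn_real_consequenceSystem hε
  · intro x N hN ε hε
    have h : EntailsIn ℝ (N.eqns x) ε ↔ EntailsIn ℝ N.elim ε := by
      refine ⟨fun h v hv => ?_, fun h v hv => h v (NormalSystem.holds_elim_of_holds_eqns hv)⟩
      obtain ⟨r, hr⟩ := NormalSystem.exists_holds_eqns hN hv
      refine (LEqn.holds_congr (v := Function.update v x r) fun i hi =>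
        Function.update_of_ne ?_ _ _).1 (h _ hr)
      rintro rfl
      exact hε hi
    -- Elimination need not be exact in a given ℓ-group, so the statement for the variety is
    -- transferred from `ℝ`.
    exact ⟨h, by rw [entailsLA_iff_real, entailsLA_iff_real, h]⟩
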